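/- All spaces are over $\mathbb C$; $E'$ denotes the Banach dual of $E$ and $\mathcal B(E)$ the algebra of bounded linear operators on $E$. A *dual Banach algebra* $(\mathcal A,\mathcal A_*)$ is a Banach algebra $\mathcal A$ together with a Banach space $\mathcal A_*$ such that $\mathcal A=(\mathcal A_*)'$ isometrically and the multiplication of $\mathcal A$ is separately weak$^*$-continuous, i.e. $\sigma(\mathcal A,\mathcal A_*)$-continuous. If $X$ is a Banach $\mathcal A$-bimodule (with bounded actions, not assumed unital), then $X'$ is a *dual* $\mathcal A$-bimodule with $\langle a\cdot\varphi,x\rangle=\langle\varphi,x\cdot a\rangle$ and $\langle\varphi\cdot a,x\rangle=\langle\varphi,a\cdot x\rangle$. It is *normal* if for every $\varphi\in X'$ the maps $a\mapsto a\cdot\varphi$ and $a\mapsto\varphi\cdot a$ are $\sigma(\mathcal A,\mathcal A_*)$-$\sigma(X',X)$ continuous. $(\mathcal A,\mathcal A_*)$ is *Connes-amenable* if for every normal dual $\mathcal A$-bimodule $X'$, every bounded linear weak$^*$-continuous map $d:\mathcal A\to X'$ with $d(ab)=a\cdot d(b)+d(a)\cdot b$ for all $a,b\in\mathcal A$ is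 inner, i.e. there is $\varphi\in X'$ with $d(a)=a\cdot\varphi-\varphi\cdot a$ for all $a\in\mathcal A$. For a reflexive Banach space $E$, the weak$^*$-topology of $\mathcal B(E)$ is the one given by its canonical predual $E'\widehat\otimes E$, that is, by the functionals $T\mapsto\sum_{n}\langle\mu_n,T x_n\rangle$ with $\mu_n\in E'$, $x_n\in E$ and $\sum_n\|\mu_n\|\,\|x_n\|<\infty$. For $S\subseteq\mathcal B(E)$ let $S^c=\{T\in\mathcal B(E): TR=RT \text{ for all } R\in S\}$ be its commutant. A *quasi-expectation* $\mathcal Q:\mathcal B(E)\to S^c$ is a bounded linear projection of $\mathcal B(E)$ onto $S^c$ such that $\mathcal Q(cTd)=c\,\mathcal Q(T)\,d$ for all $c,d\in S^c$ and $T\in\mathcal B(E)$. A unital dual Banach algebra $(\mathcal A,\mathcal A_*)$ is *injective* if for every reflexive Banach space $E$ and every weak$^*$-continuous unital algebra homomorphism $\pi:\mathcal A\to\mathcal B(E)$ there is a quasi-expectation $\mathcal Q:\mathcal B(E)\to\pi(\mathcal A)^c$. **Theorem.** Let $(\mathcal A,\mathcal A_*)$ be a unital dual Banach algebra. Then $\mathcal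 A$ is Connes-amenable if and only if $\mathcal A$ is injective. -/

import Mathlib

open Topology

universe u

/-- The topology `σ(A, P)` on `A` for an isometric identification `A = P'`. -/
noncomputable abbrev weakStarTopology {A P : Type u} [NormedRing A] [NormedAlgebra ℂ A]
    [NormedAddCommGroup P] [NormedSpace ℂ P] (Φ : A ≃ₗᵢ[ℂ] StrongDual ℂ P) :
    TopologicalSpace A :=
  TopologicalSpace.induced (fun a : A => StrongDual.toWeakDual (Φ a)) inferInstance

/-- The structure of a (unital) dual Banach algebra `(A, P)`: an isometric identification of `A`
with the Banach dual of the predual `P`, such that the multiplication of `A` is separately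
weak*-continuous. (`NormedRing` supplies a unit and a submultiplicative norm; the norm of the unit
is not restricted.) -/
structure DualBanachAlgebra (A P : Type u) [NormedRing A] [NormedAlgebra ℂ A]
    [NormedAddCommGroup P] [NormedSpace ℂ P] [CompleteSpace P] where
  /-- the identification `A = P'` -/
  toDual : A ≃ₗᵢ[ℂ] StrongDual ℂ P
  continuous_mul_left : ∀ a : A,
    Continuous[weakStarTopology toDual, weakStarTopology toDual] (fun b : A => a * b)
  continuous_mul_right : ∀ a : A,
    Continuous[weakStarTopology toDual, weakStarTopology toDual] (fun b : A => b * a)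

/-- A Banach `A`-bimodule structure on `X`: commuting bounded left and right actions of `A`.
As usual for Banach modules, the unit of `A` need not act as the identity. -/
structure BanachBimodule (A X : Type u) [NormedRing A] [NormedAlgebra ℂ A]
    [NormedAddCommGroup X] [NormedSpace ℂ X] where
  /-- `left a x = a · x` -/
  left : A →L[ℂ] X →L[ℂ] X
  /-- `right a x = x · a` -/
  right : A →L[ℂ] X →L[ℂ] X
  left_mul : ∀ (a b : A) (x : X), left (a * b) x = left a (left b x)
  right_mul : ∀ (a b : A) (x : X), right (a * b) x = right b (right a x)
  left_right : ∀ (a b : A) (x : X), left a (right b x) = right b (left a x)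

namespace BanachBimodule

variable {A X : Type u} [NormedRing A] [NormedAlgebra ℂ A]
  [NormedAddCommGroup X] [NormedSpace ℂ X]

/-- The left action on the dual bimodule `X'`: `⟨a · φ, x⟩ = ⟨φ, x · a⟩`. -/
noncomputable def dualLeft (M : BanachBimodule A X) (a : A) (φ : StrongDual ℂ X) : StrongDual ℂ X :=
  φ.comp (M.right a)

/-- The right action on the dual bimodule `X'`: `⟨φ · a, x⟩ = ⟨φ, a · x⟩`. -/
noncomputable def dualRight (M : BanachBimodule A X) (φ : StrongDual ℂ X) (a : A) : StrongDual ℂ X :=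
  φ.comp (M.left a)

end BanachBimodule

/-- A Banach space is reflexive if the canonical map into its bidual is onto. -/
def IsReflexiveSpace (E : Type u) [NormedAddCommGroup E] [NormedSpace ℂ E] : Prop :=
  Function.Surjective (NormedSpace.inclusionInDoubleDual ℂ E)

/-- The weak* topology of `B(E)`, for reflexive `E`, given by its canonical predual, the projective
tensor product `E' ⊗̂ E`. The elements of `E' ⊗̂ E` are the sums `∑ μₙ ⊗ xₙ` with
`∑ ‖μₙ‖ ‖xₙ‖ < ∞`, and such an element is paired with `T` to `∑ μₙ (T xₙ)`. -/
noncomputable abbrev operatorWeakStarTopology (E : Type u) [NormedAddCommGroup E] [NormedSpace ℂ E] :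
    TopologicalSpace (E →L[ℂ] E) :=
  TopologicalSpace.induced
    (fun (T : E →L[ℂ] E)
        (τ : {p : (ℕ → StrongDual ℂ E) × (ℕ → E) // Summable fun n => ‖p.1 n‖ * ‖p.2 n‖}) =>
      ∑' n, τ.1.1 n (T (τ.1.2 n)))
    inferInstance

/-- `Q` is a quasi-expectation for the set `S ⊆ B(E)`: a bounded linear projection of `B(E)` onto
the commutant `Sᶜ` with `Q (c T d) = c (Q T) d` for `c, d ∈ Sᶜ`. -/
structure IsQuasiExpectation {E : Type u} [NormedAddCommGroup E] [NormedSpace ℂ E]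
    (S : Set (E →L[ℂ] E)) (Q : (E →L[ℂ] E) →L[ℂ] (E →L[ℂ] E)) : Prop where
  mem_commutant : ∀ T : E →L[ℂ] E, Q T ∈ Set.centralizer S
  apply_of_mem : ∀ T ∈ Set.centralizer S, Q T = T
  map_mul_mul : ∀ c ∈ Set.centralizer S, ∀ d ∈ Set.centralizer S, ∀ T : E →L[ℂ] E,
    Q (c * T * d) = c * Q T * d

namespace DualBanachAlgebra

variable {A P : Type u} [NormedRing A] [NormedAlgebra ℂ A]
  [NormedAddCommGroup P] [NormedSpace ℂ P] [CompleteSpace P]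

/-- The weak* topology `σ(A, P)` of a dual Banach algebra. -/
noncomputable abbrev weakStar (D : DualBanachAlgebra A P) : TopologicalSpace A :=
  weakStarTopology D.toDual

/-- A map from `A` into a dual space `X'` is weak*-continuous. -/
def WeakStarContinuous (D : DualBanachAlgebra A P) {X : Type u} [NormedAddCommGroup X]
    [NormedSpace ℂ X] (f : A → StrongDual ℂ X) : Prop :=
  Continuous[D.weakStar, inferInstance] (fun a : A => StrongDual.toWeakDual (f a))

/-- The dual bimodule `X'` is normal: for every `φ ∈ X'`, both `a ↦ a · φ` and `a ↦ φ · a` are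
weak*-continuous. -/
def IsNormal (D : DualBanachAlgebra A P) {X : Type u} [NormedAddCommGroup X] [NormedSpace ℂ X]
    (M : BanachBimodule A X) : Prop :=
  ∀ φ : StrongDual ℂ X,
    D.WeakStarContinuous (fun a => M.dualLeft a φ) ∧
    D.WeakStarContinuous (fun a => M.dualRight φ a)

/-- Every weak*-continuous (bounded) derivation into a normal dual Banach bimodule is inner. -/
def ConnesAmenable (D : DualBanachAlgebra A P) : Prop :=
  ∀ (X : Type u) [NormedAddCommGroup X] [NormedSpace ℂ X] [CompleteSpace X]
    (M : BanachBimodule A X), D.IsNormal M →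
    ∀ d : A →L[ℂ] StrongDual ℂ X,
      (∀ a b : A, d (a * b) = M.dualLeft a (d b) + M.dualRight (d a) b) →
      D.WeakStarContinuous d →
      ∃ φ : StrongDual ℂ X, ∀ a : A, d a = M.dualLeft a φ - M.dualRight φ a

/-- Every weak*-continuous unital representation on a reflexive Banach space `E` admits a
quasi-expectation from `B(E)` onto the commutant of its image. -/
def Injective (D : DualBanachAlgebra A P) : Prop :=
  ∀ (E : Type u) [NormedAddCommGroup E] [NormedSpace ℂ E] [CompleteSpace E],
    IsReflexiveSpace E →
    ∀ π : A →ₐ[ℂ] (E →L[ℂ] E),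
      Continuous[D.weakStar, operatorWeakStarTopology E] π →
      ∃ Q : (E →L[ℂ] E) →L[ℂ] (E →L[ℂ] E), IsQuasiExpectation (Set.range π) Q

end DualBanachAlgebra

/-! Connes-amenable implies injective. For a representation π on a reflexive E, let G be the space
of operators U on B(E) that vanish on the commutant of π(A) and are bimodule maps over it. Then
δ(a)(T) = π(a)T − Tπ(a) is a derivation into G. The closed span of the functionals U ↦ ⟨μ, U(T)x⟩
serves as a predual of G because E is reflexive (`exists_matrixCoefficient_eq_bidual`), so δ is
implemented by some U in G (`ConnesAmenable.exists_implementing`). Then T − U(T) commutes with π(A),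
and id − U is a quasi-expectation.

Injective implies Connes-amenable. For a derivation d into X', the defect d(bc) − d(b)·c = b·d(c) is
a left module map in b. Suppose a projection onto module maps, compatible with composition by module
maps, turned d into U with U(b) = b·w. It would fix the defect, and b = 1 would give c·w − w·c =
d(c), up to the action of the unit. Injectivity supplies such projections between reflexive modules
only: a quasi-expectation on B(E × F) restricts to the corner of operators from E to F
(`Injective.exists_hom_projection`). So A and X' are replaced by reflexive models. For a
finite-dimensional K in X, a functional φ is represented by its coefficients (κ, a) ↦ φ(κ·a), and b
by its orbit b' ↦ coefficients of d(b'b). Normality and weak*-continuity of d force the second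
adjoints of both maps to take values in the target spaces. The Davis–Figiel–Johnson–Pełczyński
factorization then gives reflexive spaces (`InterpolationSpace.isReflexiveSpace`), and its
functoriality makes them normal modules (`NormalModule.exists_interpolation`). Projecting once on
the ℓ²-sum of all pieces keeps the results uniformly bounded and compatible with maps between pieces
(`Injective.exists_uniform_projection`). This yields functionals of bounded norm that satisfy the
required identity on each finite set (`Injective.exists_functional`). Banach–Alaoglu produces a
global one, and a last correction handles a unit that need not act as the identity. -/

section HahnBanach

/-! ### Consequences of Hahn–Banach and criteria for reflexivity. -/

/-- A linear functional dominated by the norm of a linear map factors through that map. -/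
theorem exists_dual_comp_eq {V W : Type*} [AddCommGroup V] [Module ℂ V] [NormedAddCommGroup W]
    [NormedSpace ℂ W] (g : V →ₗ[ℂ] W) (θ : V →ₗ[ℂ] ℂ) {C : ℝ} (hC : 0 ≤ C)
    (h : ∀ v, ‖θ v‖ ≤ C * ‖g v‖) :
    ∃ Θ : StrongDual ℂ W, ‖Θ‖ ≤ C ∧ ∀ v, Θ (g v) = θ v := by
  have hker : LinearMap.ker g ≤ LinearMap.ker θ := fun v hv => by
    have := h v
    rw [LinearMap.mem_ker.1 hv, norm_zero, mul_zero] at this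
    exact norm_le_zero_iff.1 this
  let ψ : LinearMap.range g →ₗ[ℂ] ℂ :=
    ((LinearMap.ker g).liftQ θ hker).comp g.quotKerEquivRange.symm.toLinearMap
  have hψ : ∀ v, ψ ⟨g v, v, rfl⟩ = θ v := fun v => by
    have : g.quotKerEquivRange.symm ⟨g v, v, rfl⟩ = (LinearMap.ker g).mkQ v :=
      g.quotKerEquivRange_symm_apply_image v ⟨v, rfl⟩
    simp only [ψ, LinearMap.comp_apply, LinearEquiv.coe_coe, this]
    simp
  have hb : ∀ w : LinearMap.range g, ‖ψ w‖ ≤ C * ‖w‖ := by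
    rintro ⟨_, v, rfl⟩
    rw [hψ]
    exact h v
  obtain ⟨Θ, h1, h2⟩ := exists_extension_norm_eq (𝕜 := ℂ) (LinearMap.range g)
    (ψ.mkContinuous C hb)
  refine ⟨Θ, h2 ▸ LinearMap.mkContinuous_norm_le _ hC _, fun v => ?_⟩
  have := h1 ⟨g v, v, rfl⟩
  simpa [hψ] using this

/-- In a Banach space, an element of the bidual that is a norm limit of points is a point. -/
theorem exists_eq_of_bidual_approx {Z : Type*} [NormedAddCommGroup Z] [NormedSpace ℂ Z]
    [CompleteSpace Z] (θ : StrongDual ℂ (StrongDual ℂ Z))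
    (h : ∀ ε > 0, ∃ z : Z, ∀ ζ : StrongDual ℂ Z, ‖θ ζ - ζ z‖ ≤ ε * ‖ζ‖) :
    ∃ z : Z, ∀ ζ : StrongDual ℂ Z, θ ζ = ζ z := by
  have hcl : IsClosed (Set.range (NormedSpace.inclusionInDoubleDualLi (E := Z) ℂ)) :=
    (NormedSpace.inclusionInDoubleDualLi (E := Z) ℂ).isometry.isUniformInducing.isComplete_range.isClosed
  have : θ ∈ Set.range (NormedSpace.inclusionInDoubleDualLi (E := Z) ℂ) := by
    rw [← hcl.closure_eq]
    refine (Metric.mem_closure_iff (α := StrongDual ℂ (StrongDual ℂ Z))).2 fun ε hε => ?_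
    obtain ⟨z, hz⟩ := h (ε / 2) (half_pos hε)
    refine ⟨_, ⟨z, rfl⟩, ?_⟩
    refine (dist_eq_norm (E := StrongDual ℂ (StrongDual ℂ Z)) θ _).trans_lt ?_
    refine lt_of_le_of_lt (ContinuousLinearMap.opNorm_le_bound _ (half_pos hε).le ?_)
      (half_lt_self hε)
    intro ζ
    exact hz ζ
  obtain ⟨z, rfl⟩ := this
  exact ⟨z, fun ζ => rfl⟩

theorem isReflexiveSpace_iff {E : Type u} [NormedAddCommGroup E] [NormedSpace ℂ E] :
    IsReflexiveSpace E ↔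
      ∀ η : StrongDual ℂ (StrongDual ℂ E), ∃ e : E, ∀ f : StrongDual ℂ E, η f = f e := by
  refine forall_congr' fun η => exists_congr fun e => ?_
  rw [eq_comm, ContinuousLinearMap.ext_iff]
  rfl

/-- In a reflexive space, a subspace of the dual that separates points is dense. -/
theorem IsReflexiveSpace.topologicalClosure_eq_top {E : Type u} [NormedAddCommGroup E]
    [NormedSpace ℂ E] (hE : IsReflexiveSpace E) (S : Submodule ℂ (StrongDual ℂ E))
    (hS : ∀ e : E, (∀ f ∈ S, f e = 0) → e = 0) : S.topologicalClosure = ⊤ := by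
  by_contra hd
  obtain ⟨f, hf⟩ : ∃ f, f ∉ S.topologicalClosure := by
    by_contra hcon
    push Not at hcon
    exact hd (Submodule.eq_top_iff'.2 hcon)
  have : IsClosed (S.topologicalClosure.toAddSubgroup : Set (StrongDual ℂ E)) :=
    S.isClosed_topologicalClosure
  have hne : ‖S.topologicalClosure.mkQ f‖ ≠ 0 := fun h0 =>
    hf ((QuotientAddGroup.norm_mk_eq_zero (S := S.topologicalClosure.toAddSubgroup)).1 h0)
  -- A functional on the quotient pulls back to an element of the bidual that kills S. Reflexivity
  -- makes it evaluation at a point e, which separation forces to be 0.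
  obtain ⟨g, -, hg⟩ := exists_dual_vector ℂ (S.topologicalClosure.mkQ f) hne
  obtain ⟨e, he⟩ := isReflexiveSpace_iff.1 hE (g.comp S.topologicalClosure.mkQL)
  have he0 : e = 0 := hS e fun f' hf' => by
    rw [← he f']
    have : S.topologicalClosure.mkQ f' = 0 := by
      simpa using S.le_topologicalClosure hf'
    rw [ContinuousLinearMap.comp_apply, Submodule.mkQL_apply, this, map_zero]
  have h1 := he f
  rw [he0, map_zero] at h1
  have h2 : g (S.topologicalClosure.mkQ f) = 0 := h1
  rw [hg] at h2
  exact hne (Complex.ofReal_eq_zero.1 h2)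

end HahnBanach

/-! ### Functionals on ℓ²-sums and reflexivity of ℓ²-sums. -/

namespace lp

variable {ι : Type*} {V : ι → Type*} [∀ i, NormedAddCommGroup (V i)]

theorem hasSum_norm_sq (f : lp V 2) : HasSum (fun i => ‖f i‖ ^ 2) (‖f‖ ^ 2) := by
  simpa using lp.hasSum_norm (p := 2) (by simp) f

theorem sum_norm_sq_le (f : lp V 2) (s : Finset ι) : ∑ i ∈ s, ‖f i‖ ^ 2 ≤ ‖f‖ ^ 2 :=
  sum_le_hasSum s (fun _ _ => by positivity) (hasSum_norm_sq f)

theorem norm_add_sq_of_disjoint (f g : lp V 2) (h : ∀ i, f i = 0 ∨ g i = 0) :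
    ‖f + g‖ ^ 2 = ‖f‖ ^ 2 + ‖g‖ ^ 2 := by
  refine (hasSum_norm_sq (f + g)).unique ?_
  convert (hasSum_norm_sq f).add (hasSum_norm_sq g) using 2 with i
  rcases h i with h | h <;> simp [h]

theorem memℓp_two_of_sum_le {f : ∀ i, V i} {C : ℝ} (h : ∀ s : Finset ι, ∑ i ∈ s, ‖f i‖ ^ 2 ≤ C) :
    Memℓp f 2 :=
  memℓp_gen' (C := C) (by simpa using h)

variable [DecidableEq ι]

theorem sum_single_apply (f : ∀ i, V i) (s : Finset ι) (i : ι) :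
    (∑ j ∈ s, lp.single (E := V) 2 j (f j)) i = if i ∈ s then f i else 0 := by
  rw [lp.coeFn_sum]
  simp only [lp.coeFn_single, Finset.sum_apply, Finset.sum_pi_single]

variable [∀ i, NormedSpace ℂ (V i)]

/-- A functional on an `ℓ²`-sum is small far away. -/
theorem exists_finset_norm_le (F : StrongDual ℂ (lp V 2)) {ε : ℝ} (hε : 0 < ε) :
    ∃ s : Finset ι, ∀ w : lp V 2, (∀ i ∈ s, w i = 0) → ‖F w‖ ≤ ε * ‖w‖ := by
  set N := ‖F‖
  have hN : 0 ≤ N := norm_nonneg F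
  -- If v nearly norms F and w has disjoint support, then v + t w/‖w‖ has norm at most 1 + t²/2.
  -- After aligning phases this gives N − tε/2 + t‖F w‖/‖w‖ ≤ N(1 + t²/2). The gain is linear in t
  -- and the cost quadratic; since N t ≤ ε, it follows that ‖F w‖ ≤ ε‖w‖.
  set t := ε / (N + 1)
  have ht : 0 < t := by positivity
  have hNt : N * t ≤ ε := by
    rw [mul_div_assoc', div_le_iff₀ (by positivity)]
    nlinarith
  obtain ⟨v, s, hv1, hv2, hvs⟩ : ∃ (v : lp V 2) (s : Finset ι),
      ‖v‖ < 1 ∧ N - t * ε / 2 < ‖F v‖ ∧ ∀ i ∉ s, v i = 0 := by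
    obtain ⟨v, hv1, hv2⟩ := F.exists_lt_apply_of_lt_opNorm (r := N - t * ε / 2)
      (by have : 0 < t * ε := by positivity
          linarith)
    have hlim := lp.hasSum_single (p := 2) (by simp) v
    have hev : ∀ᶠ w in 𝓝 v, ‖w‖ < 1 ∧ N - t * ε / 2 < ‖F w‖ :=
      (continuous_norm.continuousAt.eventually_lt_const hv1).and
        ((F.continuous.norm.continuousAt).eventually_const_lt hv2)
    obtain ⟨s, hs⟩ := (hlim.eventually hev).exists
    refine ⟨_, s, hs.1, hs.2, fun i hi => ?_⟩
    rw [sum_single_apply, if_neg hi]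
  refine ⟨s, fun w hw => ?_⟩
  rcases eq_or_ne w 0 with rfl | hw0
  · simp
  have hwn : 0 < ‖w‖ := norm_pos_iff.2 hw0
  obtain ⟨a, ha, hav⟩ := RCLike.exists_norm_eq_mul_self (F v)
  obtain ⟨b, hb, hbw⟩ := RCLike.exists_norm_eq_mul_self (F w)
  set r : ℝ := t / ‖w‖
  have hrw : r * ‖w‖ = t := div_mul_cancel₀ _ hwn.ne'
  have hr : 0 < r := by positivity
  have hsq : ‖a • v + ((r : ℂ) * b) • w‖ ^ 2 = ‖v‖ ^ 2 + t ^ 2 := by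
    rw [norm_add_sq_of_disjoint, norm_smul, norm_smul, ha, norm_mul, hb, Complex.norm_real,
      Real.norm_of_nonneg hr.le, one_mul, mul_one, hrw]
    intro i
    by_cases hi : i ∈ s
    · right; simp [hw i hi]
    · left; simp [hvs i hi]
  have hle : ‖a • v + ((r : ℂ) * b) • w‖ ≤ 1 + t ^ 2 / 2 := by
    refine abs_le_of_sq_le_sq' ?_ (by positivity) |>.2
    rw [hsq]
    nlinarith [norm_nonneg v, sq_nonneg (t ^ 2)]
  have hF : F (a • v + ((r : ℂ) * b) • w) = ((‖F v‖ + r * ‖F w‖ : ℝ) : ℂ) := by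
    rw [map_add, map_smul, map_smul, smul_eq_mul, smul_eq_mul, ← hav, mul_assoc, ← hbw]
    push_cast
    rfl
  have h1 := F.le_opNorm (a • v + ((r : ℂ) * b) • w)
  rw [hF, Complex.norm_real, Real.norm_of_nonneg (by positivity)] at h1
  have h2 : ‖F v‖ + r * ‖F w‖ ≤ N * (1 + t ^ 2 / 2) :=
    h1.trans (mul_le_mul_of_nonneg_left hle hN)
  have h3 : r * ‖F w‖ ≤ t * ε := by nlinarith
  have h4 : r * ‖F w‖ ≤ r * (ε * ‖w‖) := by
    calc r * ‖F w‖ ≤ t * ε := h3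
      _ = r * (ε * ‖w‖) := by rw [← hrw]; ring
  exact le_of_mul_le_mul_left h4 hr

/-- The functionals depending on finitely many coordinates are dense in the dual of an
`ℓ²`-sum. -/
theorem exists_finset_norm_sub_le (F : StrongDual ℂ (lp V 2)) {ε : ℝ} (hε : 0 < ε) :
    ∃ s : Finset ι, ‖F - ∑ i ∈ s, (F.comp (singleContinuousLinearMap ℂ V 2 i)).comp
      (evalCLM ℂ V 2 i)‖ ≤ ε := by
  obtain ⟨s, hs⟩ := exists_finset_norm_le F hε
  refine ⟨s, ContinuousLinearMap.opNorm_le_bound _ hε.le fun v => ?_⟩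
  have h1 : (F - ∑ i ∈ s, (F.comp (singleContinuousLinearMap ℂ V 2 i)).comp
      (evalCLM ℂ V 2 i)) v = F (v - ∑ i ∈ s, lp.single 2 i (v i)) := by
    simp only [_root_.sub_apply, _root_.sum_apply, map_sub, map_sum]
    rfl
  have h0 : ∀ i ∈ s, (v - ∑ i ∈ s, lp.single (E := V) 2 i (v i)) i = 0 := fun i hi => by
    rw [lp.coeFn_sub, Pi.sub_apply, sum_single_apply, if_pos hi, sub_self]
  rw [h1]
  refine (hs _ h0).trans (mul_le_mul_of_nonneg_left ?_ hε.le)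
  have h2 := norm_add_sq_of_disjoint (v - ∑ i ∈ s, lp.single 2 i (v i))
    (∑ i ∈ s, lp.single 2 i (v i)) fun i => by
      by_cases hi : i ∈ s
      · exact Or.inl (h0 i hi)
      · right
        rw [sum_single_apply, if_neg hi]
  rw [sub_add_cancel] at h2
  exact abs_le_of_sq_le_sq' (by nlinarith [sq_nonneg ‖∑ i ∈ s, lp.single (E := V) 2 i (v i)‖])
    (norm_nonneg _) |>.2

/-- An element of the bidual of a space contractively mapped into an `ℓ²`-sum whose coordinates are points is given by
an element of the `ℓ²`-sum. -/
theorem bidual_eq_of_coordinates {G : Type*} [NormedAddCommGroup G] [NormedSpace ℂ G]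
    (j : G →L[ℂ] lp V 2) (hj : ‖j‖ ≤ 1) (η : StrongDual ℂ (StrongDual ℂ G)) (s : ∀ i, V i)
    (hs : ∀ i (f : StrongDual ℂ (V i)),
      η ((f.comp (evalCLM ℂ V 2 i)).comp j) = f (s i)) :
    ∃ h : Memℓp s 2, ∀ F : StrongDual ℂ (lp V 2), η (F.comp j) = F ⟨s, h⟩ := by
  have hmem : Memℓp s 2 := by
    refine memℓp_two_of_sum_le (C := ‖η‖ ^ 2) fun S => ?_
    choose f hf1 hf2 using fun i => exists_dual_vector'' ℂ (s i)
    set c := ∑ i ∈ S, ‖s i‖ ^ 2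
    have hc : 0 ≤ c := Finset.sum_nonneg fun i _ => by positivity
    -- Weighting norming functionals by ‖s i‖ makes η g = c, while Cauchy–Schwarz gives ‖g‖ ≤ √c;
    -- hence c ≤ ‖η‖².
    let g : StrongDual ℂ G :=
      ∑ i ∈ S, (‖s i‖ : ℂ) • (((f i).comp (evalCLM ℂ V 2 i)).comp j)
    have hg : η g = (c : ℂ) := by
      simp only [g, map_sum, map_smul, hs, hf2, c]
      push_cast
      refine Finset.sum_congr rfl fun i _ => ?_
      rw [smul_eq_mul, sq]
      rfl
    have hgn : ‖g‖ ≤ √c := by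
      refine ContinuousLinearMap.opNorm_le_bound _ (Real.sqrt_nonneg _) fun v => ?_
      calc ‖g v‖ ≤ ∑ i ∈ S, ‖s i‖ * ‖(j v) i‖ := by
            simp only [g, _root_.sum_apply]
            refine (norm_sum_le _ _).trans (Finset.sum_le_sum fun i _ => ?_)
            rw [_root_.smul_apply, norm_smul, Complex.norm_real, norm_norm]
            exact mul_le_mul_of_nonneg_left ((f i).le_of_opNorm_le_of_le (hf1 i) le_rfl |>.trans
              (by rw [one_mul]; rfl)) (norm_nonneg _)
        _ ≤ √c * √(∑ i ∈ S, ‖(j v) i‖ ^ 2) := Real.sum_mul_le_sqrt_mul_sqrt _ _ _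
        _ ≤ √c * ‖v‖ := by
            gcongr
            exact Real.sqrt_le_iff.2 ⟨norm_nonneg _, (sum_norm_sq_le (j v) S).trans
              (pow_le_pow_left₀ (norm_nonneg _) (j.le_of_opNorm_le hj v |>.trans_eq (one_mul _)) 2)⟩
    have h1 : c ≤ ‖η‖ * √c := by
      have := (η.le_opNorm g).trans (mul_le_mul_of_nonneg_left hgn (norm_nonneg _))
      rwa [hg, Complex.norm_real, Real.norm_of_nonneg hc] at this
    have h2 : √c * √c = c := Real.mul_self_sqrt hc
    rcases hc.eq_or_lt with h0 | h0
    · rw [← h0]; positivity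
    · have h3 : 0 < √c := Real.sqrt_pos.2 h0
      have h4 : √c ≤ ‖η‖ := by
        refine le_of_mul_le_mul_right ?_ h3
        rwa [h2]
      nlinarith
  refine ⟨hmem, fun F => ?_⟩
  refine eq_of_forall_dist_le fun ε hε => ?_
  set x : lp V 2 := ⟨s, hmem⟩
  -- Both sides agree on finitely supported functionals. The truncation error enters once through η
  -- and once through x, which fixes the denominator.
  obtain ⟨S, hS⟩ := exists_finset_norm_sub_le F
    (ε := ε / (‖η‖ + ‖x‖ + 1)) (by positivity)
  set FS := ∑ i ∈ S, (F.comp (singleContinuousLinearMap ℂ V 2 i)).comp (evalCLM ℂ V 2 i)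
  have hFS : η (FS.comp j) = FS x := by
    have : FS.comp j = ∑ i ∈ S,
        ((F.comp (singleContinuousLinearMap ℂ V 2 i)).comp (evalCLM ℂ V 2 i)).comp
          j := by
      ext v; simp [FS]
    rw [this, map_sum]
    simp only [hs, FS, _root_.sum_apply]
    rfl
  have h1 : ‖η (F.comp j) - η (FS.comp j)‖ ≤ ‖η‖ * ‖F - FS‖ := by
    rw [← map_sub, ← ContinuousLinearMap.sub_comp]
    refine (η.le_opNorm _).trans (mul_le_mul_of_nonneg_left ?_ (norm_nonneg _))
    refine (ContinuousLinearMap.opNorm_comp_le _ _).trans ?_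
    exact mul_le_of_le_one_right (norm_nonneg _) hj
  have h2 : ‖FS x - F x‖ ≤ ‖F - FS‖ * ‖x‖ := by
    rw [norm_sub_rev, ← _root_.sub_apply]
    exact (F - FS).le_opNorm x
  rw [dist_eq_norm]
  calc ‖η (F.comp j) - F x‖
      ≤ ‖η (F.comp j) - η (FS.comp j)‖ + ‖FS x - F x‖ := by
        rw [← hFS]; exact norm_sub_le_norm_sub_add_norm_sub _ _ _
    _ ≤ (‖η‖ + ‖x‖) * ‖F - FS‖ := by linarith
    _ ≤ (‖η‖ + ‖x‖ + 1) * (ε / (‖η‖ + ‖x‖ + 1)) := by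
        refine mul_le_mul (le_add_of_nonneg_right zero_le_one) hS (norm_nonneg _) (by positivity)
    _ = ε := mul_div_cancel₀ _ (by positivity)

/-- An `ℓ²`-sum of reflexive spaces is reflexive. -/
theorem isReflexiveSpace {ι : Type u} {V : ι → Type u} [∀ i, NormedAddCommGroup (V i)]
    [∀ i, NormedSpace ℂ (V i)] (hV : ∀ i, IsReflexiveSpace (V i)) :
    IsReflexiveSpace (lp V 2) := by
  classical
  refine isReflexiveSpace_iff.2 fun η => ?_
  choose s hs using fun i => isReflexiveSpace_iff.1 (hV i)
    (η.comp ((ContinuousLinearMap.compL ℂ (lp V 2) (V i) ℂ).flip (evalCLM ℂ V 2 i)))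
  obtain ⟨h, h'⟩ := bidual_eq_of_coordinates (ContinuousLinearMap.id ℂ (lp V 2))
    ContinuousLinearMap.norm_id_le η s fun i f => hs i f
  exact ⟨⟨s, h⟩, h'⟩

end lp

/-! ### Factorization of operators through an interpolation space -/

namespace InterpolationSpace

variable {Y Z Y' Z' : Type u} [NormedAddCommGroup Y] [NormedSpace ℂ Y] [NormedAddCommGroup Z]
  [NormedSpace ℂ Z] [NormedAddCommGroup Y'] [NormedSpace ℂ Y'] [NormedAddCommGroup Z']
  [NormedSpace ℂ Z']

/-- The map `(y, z) ↦ 2ⁿ u y + 2⁻ⁿ z`. -/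
noncomputable def levelMap (u : Y →L[ℂ] Z) (n : ℕ) : Y × Z →L[ℂ] Z :=
  (2 ^ n : ℂ) • u.comp (ContinuousLinearMap.fst ℂ Y Z) +
    (2 ^ n : ℂ)⁻¹ • ContinuousLinearMap.snd ℂ Y Z

theorem levelMap_apply (u : Y →L[ℂ] Z) (n : ℕ) (p : Y × Z) :
    levelMap u n p = (2 ^ n : ℂ) • u p.1 + (2 ^ n : ℂ)⁻¹ • p.2 := rfl

theorem levelMap_surjective (u : Y →L[ℂ] Z) (n : ℕ) : Function.Surjective (levelMap u n) :=
  fun z => ⟨(0, (2 ^ n : ℂ) • z), by simp [levelMap_apply]⟩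

/-- The space `Z` with the gauge of `2ⁿ u(B_Y) + 2⁻ⁿ B_Z` as its norm, realized as a quotient of
`Y × Z`. -/
def Level (u : Y →L[ℂ] Z) (n : ℕ) : Type u :=
  (Y × Z) ⧸ LinearMap.ker (levelMap u n).toLinearMap

instance (u : Y →L[ℂ] Z) (n : ℕ) :
    IsClosed (LinearMap.ker (levelMap u n).toLinearMap : Set (Y × Z)) :=
  (levelMap u n).isClosed_ker

noncomputable instance (u : Y →L[ℂ] Z) (n : ℕ) : NormedAddCommGroup (Level u n) :=
  inferInstanceAs (NormedAddCommGroup ((Y × Z) ⧸ LinearMap.ker (levelMap u n).toLinearMap))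

noncomputable instance (u : Y →L[ℂ] Z) (n : ℕ) : NormedSpace ℂ (Level u n) :=
  inferInstanceAs (NormedSpace ℂ ((Y × Z) ⧸ LinearMap.ker (levelMap u n).toLinearMap))

instance [CompleteSpace Y] [CompleteSpace Z] (u : Y →L[ℂ] Z) (n : ℕ) :
    CompleteSpace (Level u n) :=
  inferInstanceAs (CompleteSpace ((Y × Z) ⧸ LinearMap.ker (levelMap u n).toLinearMap))

/-- The underlying identification of `Level u n` with `Z`. -/
noncomputable def levelEquiv (u : Y →L[ℂ] Z) (n : ℕ) : Level u n ≃ₗ[ℂ] Z :=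
  (levelMap u n).toLinearMap.quotKerEquivOfSurjective (levelMap_surjective u n)

/-- The norm of `Level` is a quotient norm, so any decomposition of a point bounds it. With the
nearly optimal decompositions of `exists_levelMap_eq`, this gives access to the gauge. -/
theorem norm_levelEquiv_symm_le (u : Y →L[ℂ] Z) (n : ℕ) (p : Y × Z) :
    ‖(levelEquiv u n).symm (levelMap u n p)‖ ≤ ‖p‖ := by
  let s : Level u n := (LinearMap.ker (levelMap u n).toLinearMap).mkQ p
  have hs : levelEquiv u n s = levelMap u n p := rfl
  rw [← hs, LinearEquiv.symm_apply_apply]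
  exact Submodule.Quotient.norm_mk_le _ p

theorem exists_levelMap_eq (u : Y →L[ℂ] Z) (n : ℕ) (s : Level u n) {ε : ℝ} (hε : 0 < ε) :
    ∃ p : Y × Z, levelMap u n p = levelEquiv u n s ∧ ‖p‖ < ‖s‖ + ε := by
  obtain ⟨p, hp, hlt⟩ := Submodule.Quotient.norm_mk_lt
    (S := LinearMap.ker (levelMap u n).toLinearMap) s hε
  exact ⟨p, by rw [← hp]; rfl, hlt⟩

/-- The pair (α, β) carries a nearly optimal decomposition of a point to a decomposition of its
image. -/
theorem norm_levelEquiv_comp_le (u : Y →L[ℂ] Z) (u' : Y' →L[ℂ] Z') (n : ℕ) (α : Y →L[ℂ] Y')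
    (β : Z →L[ℂ] Z') (h : ∀ y, β (u y) = u' (α y)) {C : ℝ} (hα : ‖α‖ ≤ C) (hβ : ‖β‖ ≤ C)
    (s : Level u n) : ‖(levelEquiv u' n).symm (β (levelEquiv u n s))‖ ≤ C * ‖s‖ := by
  have hC : 0 ≤ C := (norm_nonneg _).trans hα
  refine le_of_forall_pos_le_add fun ε hε => ?_
  obtain ⟨p, hp, hlt⟩ := exists_levelMap_eq u n s (ε := ε / (C + 1)) (by positivity)
  have h1 : β (levelEquiv u n s) = levelMap u' n (α p.1, β p.2) := by
    rw [← hp, levelMap_apply, levelMap_apply, map_add, map_smul, map_smul, h]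
  rw [h1]
  refine (norm_levelEquiv_symm_le u' n _).trans ?_
  have h2 : ‖(α p.1, β p.2)‖ ≤ C * ‖p‖ := by
    rw [Prod.norm_def]
    exact max_le ((α.le_of_opNorm_le hα _).trans (mul_le_mul_of_nonneg_left (norm_fst_le p) hC))
      ((β.le_of_opNorm_le hβ _).trans (mul_le_mul_of_nonneg_left (norm_snd_le p) hC))
  have h3 : C * (ε / (C + 1)) ≤ ε := by
    rw [mul_div_assoc', div_le_iff₀ (by positivity)]
    nlinarith
  calc _ ≤ C * ‖p‖ := h2
    _ ≤ C * (‖s‖ + ε / (C + 1)) := mul_le_mul_of_nonneg_left hlt.le hC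
    _ ≤ C * ‖s‖ + ε := by rw [mul_add]; linarith

theorem norm_levelMap_le (u : Y →L[ℂ] Z) (n : ℕ) (p : Y × Z) :
    ‖levelMap u n p‖ ≤ (2 ^ n * ‖u‖ + (2 ^ n)⁻¹) * ‖p‖ := by
  rw [levelMap_apply]
  refine (norm_add_le _ _).trans ?_
  rw [norm_smul, norm_smul, norm_inv, norm_pow, Complex.norm_ofNat, add_mul, mul_assoc]
  gcongr
  · exact (u.le_opNorm _).trans (mul_le_mul_of_nonneg_left (norm_fst_le p) (norm_nonneg _))
  · exact norm_snd_le p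

/-- `levelEquiv` as a continuous linear map. -/
noncomputable def levelTo (u : Y →L[ℂ] Z) (n : ℕ) : Level u n →L[ℂ] Z :=
  (levelEquiv u n).toLinearMap.mkContinuous (2 ^ n * ‖u‖ + (2 ^ n)⁻¹) fun s => by
    set C := 2 ^ n * ‖u‖ + ((2 : ℝ) ^ n)⁻¹
    have hC : 0 ≤ C := by positivity
    refine le_of_forall_pos_le_add fun ε hε => ?_
    obtain ⟨p, hp, hlt⟩ := exists_levelMap_eq u n s (ε := ε / (C + 1)) (by positivity)
    have h3 : C * (ε / (C + 1)) ≤ ε := by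
      rw [mul_div_assoc', div_le_iff₀ (by positivity)]
      nlinarith
    rw [LinearEquiv.coe_coe, ← hp]
    calc _ ≤ C * ‖p‖ := norm_levelMap_le u n p
      _ ≤ C * (‖s‖ + ε / (C + 1)) := mul_le_mul_of_nonneg_left hlt.le hC
      _ ≤ C * ‖s‖ + ε := by rw [mul_add]; linarith

@[simp]
theorem levelTo_apply (u : Y →L[ℂ] Z) (n : ℕ) (s : Level u n) :
    levelTo u n s = levelEquiv u n s := rfl

/-- The inverse of `levelEquiv` as a continuous linear map. -/
noncomputable def levelOf (u : Y →L[ℂ] Z) (n : ℕ) : Z →L[ℂ] Level u n :=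
  (levelEquiv u n).symm.toLinearMap.mkContinuous (2 ^ n) fun z => by
    have h := norm_levelEquiv_symm_le u n (0, (2 ^ n : ℂ) • z)
    have h1 : levelMap u n (0, (2 ^ n : ℂ) • z) = z := by simp [levelMap_apply]
    rw [h1] at h
    refine h.trans_eq ?_
    rw [Prod.norm_def, norm_zero, max_eq_right (norm_nonneg _), norm_smul, norm_pow,
      Complex.norm_ofNat]

@[simp]
theorem levelOf_apply (u : Y →L[ℂ] Z) (n : ℕ) (z : Z) :
    levelOf u n z = (levelEquiv u n).symm z := rfl

/-- The decomposition u y = 2ⁿ u(2⁻ⁿ y) + 0 gives geometric decay, so the copies of u y at all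
levels are square summable. -/
theorem norm_levelOf_apply_le (u : Y →L[ℂ] Z) (n : ℕ) (y : Y) :
    ‖levelOf u n (u y)‖ ≤ (1 / 2) ^ n * ‖y‖ := by
  have h := norm_levelEquiv_symm_le u n ((2 ^ n : ℂ)⁻¹ • y, 0)
  have h1 : levelMap u n ((2 ^ n : ℂ)⁻¹ • y, 0) = u y := by
    simp [levelMap_apply]
  rw [h1] at h
  refine h.trans_eq ?_
  rw [Prod.norm_def, norm_zero, max_eq_left (norm_nonneg _), norm_smul, norm_inv, norm_pow,
    Complex.norm_ofNat, one_div, inv_pow]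

/-- The interpolation space of `u`, as the diagonal subspace of an `ℓ²`-sum. -/
noncomputable def diagonal (u : Y →L[ℂ] Z) : Submodule ℂ (lp (Level u) 2) where
  carrier := {s | ∀ n, levelTo u n (s n) = levelTo u 0 (s 0)}
  add_mem' {s t} hs ht n := by
    rw [lp.coeFn_add, Pi.add_apply, Pi.add_apply, map_add, map_add, hs n, ht n]
  zero_mem' n := by rw [lp.coeFn_zero, Pi.zero_apply, Pi.zero_apply, map_zero, map_zero]
  smul_mem' c s hs n := by
    rw [lp.coeFn_smul, Pi.smul_apply, Pi.smul_apply, map_smul, map_smul, hs n]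

theorem isClosed_diagonal (u : Y →L[ℂ] Z) : IsClosed (diagonal u : Set (lp (Level u) 2)) := by
  have : (diagonal u : Set (lp (Level u) 2)) = ⋂ n, {s | ((levelTo u n).comp
      (lp.evalCLM ℂ (Level u) 2 n)) s = ((levelTo u 0).comp (lp.evalCLM ℂ (Level u) 2 0)) s} := by
    ext s
    simp only [Set.mem_iInter]
    rfl
  rw [this]
  exact isClosed_iInter fun n =>
    isClosed_eq (ContinuousLinearMap.continuous _) (ContinuousLinearMap.continuous _)

end InterpolationSpace

open InterpolationSpace

/-- The interpolation space of an operator `u : Y → Z`: a Banach space `E` with operators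
`Y → E → Z` composing to `u`, which is reflexive if `u` is weakly compact. -/
def InterpolationSpace {Y Z : Type u} [NormedAddCommGroup Y] [NormedSpace ℂ Y]
    [NormedAddCommGroup Z] [NormedSpace ℂ Z] (u : Y →L[ℂ] Z) : Type u :=
  diagonal u

namespace InterpolationSpace

variable {Y Z Y' Z' : Type u} [NormedAddCommGroup Y] [NormedSpace ℂ Y] [NormedAddCommGroup Z]
  [NormedSpace ℂ Z] [NormedAddCommGroup Y'] [NormedSpace ℂ Y'] [NormedAddCommGroup Z']
  [NormedSpace ℂ Z']

noncomputable instance (u : Y →L[ℂ] Z) : NormedAddCommGroup (InterpolationSpace u) :=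
  inferInstanceAs (NormedAddCommGroup (diagonal u))

noncomputable instance (u : Y →L[ℂ] Z) : NormedSpace ℂ (InterpolationSpace u) :=
  inferInstanceAs (NormedSpace ℂ (diagonal u))

instance [CompleteSpace Y] [CompleteSpace Z] (u : Y →L[ℂ] Z) :
    CompleteSpace (InterpolationSpace u) :=
  (isClosed_diagonal u).completeSpace_coe

/-- The inclusion into the `ℓ²`-sum. -/
noncomputable def coord (u : Y →L[ℂ] Z) : InterpolationSpace u →L[ℂ] lp (Level u) 2 :=
  LinearMap.mkContinuous
    { toFun := fun s => s.1, map_add' := fun _ _ => rfl, map_smul' := fun _ _ => rfl } 1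
    fun s => (one_mul ‖s‖).ge

@[simp]
theorem norm_coord (u : Y →L[ℂ] Z) (s : InterpolationSpace u) : ‖coord u s‖ = ‖s‖ := rfl

theorem norm_coord_le (u : Y →L[ℂ] Z) : ‖coord u‖ ≤ 1 :=
  LinearMap.mkContinuous_norm_le _ zero_le_one _

theorem coord_injective (u : Y →L[ℂ] Z) : Function.Injective (coord u) :=
  Subtype.coe_injective

/-- The second factor `E → Z` of the factorization. -/
noncomputable def proj (u : Y →L[ℂ] Z) : InterpolationSpace u →L[ℂ] Z :=
  ((levelTo u 0).comp (lp.evalCLM ℂ (Level u) 2 0)).comp (coord u)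

theorem levelEquiv_coord (u : Y →L[ℂ] Z) (s : InterpolationSpace u) (n : ℕ) :
    levelEquiv u n (coord u s n) = proj u s :=
  s.2 n

theorem coord_apply (u : Y →L[ℂ] Z) (s : InterpolationSpace u) (n : ℕ) :
    coord u s n = levelOf u n (proj u s) := by
  rw [← levelEquiv_coord u s n, levelOf_apply, LinearEquiv.symm_apply_apply]

theorem proj_injective (u : Y →L[ℂ] Z) : Function.Injective (proj u) := fun s t h => by
  refine coord_injective u (lp.ext (funext fun n => ?_))
  rw [coord_apply, coord_apply, h]

/-- The points of `Z` belonging to the interpolation space. -/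
noncomputable def ofMem (u : Y →L[ℂ] Z) (z : Z) (h : Memℓp (fun n => levelOf u n z) 2) :
    InterpolationSpace u :=
  ⟨⟨fun n => levelOf u n z, h⟩, fun n => by
    simp only [levelTo_apply, levelOf_apply]
    rw [LinearEquiv.apply_symm_apply, LinearEquiv.apply_symm_apply]⟩

@[simp]
theorem proj_ofMem (u : Y →L[ℂ] Z) (z : Z) (h : Memℓp (fun n => levelOf u n z) 2) :
    proj u (ofMem u z h) = z :=
  (levelEquiv u 0).apply_symm_apply z

theorem sum_norm_levelOf_sq_le (u : Y →L[ℂ] Z) (y : Y) (S : Finset ℕ) :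
    ∑ n ∈ S, ‖levelOf u n (u y)‖ ^ 2 ≤ (2 * ‖y‖) ^ 2 := by
  have h : ∀ n, ‖levelOf u n (u y)‖ ^ 2 ≤ (1 / 4) ^ n * ‖y‖ ^ 2 := fun n => by
    refine (pow_le_pow_left₀ (norm_nonneg _) (norm_levelOf_apply_le u n y) 2).trans_eq ?_
    rw [mul_pow, ← pow_mul, mul_comm n 2, pow_mul]
    norm_num
  calc ∑ n ∈ S, ‖levelOf u n (u y)‖ ^ 2 ≤ ∑ n ∈ S, (1 / 4 : ℝ) ^ n * ‖y‖ ^ 2 :=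
        Finset.sum_le_sum fun n _ => h n
    _ = (∑ n ∈ S, (1 / 4 : ℝ) ^ n) * ‖y‖ ^ 2 := (Finset.sum_mul _ _ _).symm
    _ ≤ (1 - 1 / 4)⁻¹ * ‖y‖ ^ 2 := by
        gcongr
        exact sum_le_hasSum S (fun _ _ => by positivity)
          (hasSum_geometric_of_lt_one (by norm_num) (by norm_num))
    -- The geometric series sums to 4/3, which is below 2² = 4.
    _ ≤ (2 * ‖y‖) ^ 2 := by nlinarith [sq_nonneg ‖y‖]

/-- The first factor `Y → E` of the factorization. -/
noncomputable def incl (u : Y →L[ℂ] Z) : Y →L[ℂ] InterpolationSpace u :=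
  LinearMap.mkContinuous
    { toFun := fun y => ofMem u (u y) (lp.memℓp_two_of_sum_le (sum_norm_levelOf_sq_le u y))
      map_add' := fun y y' => proj_injective u (by simp)
      map_smul' := fun c y => proj_injective u (by simp) } 2 fun y => by
    refine lp.norm_le_of_forall_sum_le (p := 2) (by simp) (by positivity) fun S => ?_
    simpa using! sum_norm_levelOf_sq_le u y S

@[simp]
theorem proj_incl (u : Y →L[ℂ] Z) (y : Y) : proj u (incl u y) = u y :=
  proj_ofMem u (u y) _

theorem norm_incl_le (u : Y →L[ℂ] Z) : ‖incl u‖ ≤ 2 :=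
  LinearMap.mkContinuous_norm_le _ zero_le_two _

/-- Functoriality of the interpolation space in commutative squares. -/
theorem exists_map (u : Y →L[ℂ] Z) (u' : Y' →L[ℂ] Z') (α : Y →L[ℂ] Y')
    (β : Z →L[ℂ] Z') (h : ∀ y, β (u y) = u' (α y)) {C : ℝ} (hα : ‖α‖ ≤ C) (hβ : ‖β‖ ≤ C) :
    ∃ T : InterpolationSpace u →L[ℂ] InterpolationSpace u',
      ‖T‖ ≤ C ∧ ∀ s, proj u' (T s) = β (proj u s) := by
  have hC : 0 ≤ C := (norm_nonneg _).trans hα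
  let T : ∀ n, Level u n →L[ℂ] Level u' n := fun n => (levelOf u' n).comp (β.comp (levelTo u n))
  have hT : ∀ n, ‖T n‖ ≤ C := fun n => ContinuousLinearMap.opNorm_le_bound _ hC fun s =>
    norm_levelEquiv_comp_le u u' n α β h hα hβ s
  let L : InterpolationSpace u →L[ℂ] lp (Level u') 2 := (lp.mapCLM 2 T hC hT).comp (coord u)
  have hL : ∀ s n, L s n = levelOf u' n (β (proj u s)) := fun s n => by
    rw [← levelEquiv_coord u s n]
    rfl
  have hmem : ∀ s, Memℓp (fun n => levelOf u' n (β (proj u s))) 2 := fun s => by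
    have := lp.memℓp (L s)
    rwa [funext (hL s)] at this
  refine ⟨LinearMap.mkContinuous
    { toFun := fun s => ofMem u' (β (proj u s)) (hmem s)
      map_add' := fun s t => proj_injective u' (by simp)
      map_smul' := fun c s => proj_injective u' (by simp) } C fun s => ?_,
    LinearMap.mkContinuous_norm_le _ hC _, fun s => proj_ofMem u' _ _⟩
  have h1 : coord u' (ofMem u' (β (proj u s)) (hmem s)) = L s :=
    lp.ext (funext fun n => (hL s n).symm)
  calc ‖ofMem u' (β (proj u s)) (hmem s)‖ = ‖L s‖ := by rw [← h1, norm_coord]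
    _ ≤ C * ‖coord u s‖ := (lp.mapCLM 2 T hC hT).le_of_opNorm_le (lp.norm_mapCLM_le 2 T hC hT) _
    _ = C * ‖s‖ := by rw [norm_coord]

/-- Functoriality of the interpolation space in commutative squares. -/
noncomputable def map (u : Y →L[ℂ] Z) (u' : Y' →L[ℂ] Z') (α : Y →L[ℂ] Y')
    (β : Z →L[ℂ] Z') (h : ∀ y, β (u y) = u' (α y)) :
    InterpolationSpace u →L[ℂ] InterpolationSpace u' :=
  (exists_map u u' α β h (le_max_left ‖α‖ ‖β‖) (le_max_right ‖α‖ ‖β‖)).choose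

theorem norm_map_le (u : Y →L[ℂ] Z) (u' : Y' →L[ℂ] Z') (α : Y →L[ℂ] Y')
    (β : Z →L[ℂ] Z') (h : ∀ y, β (u y) = u' (α y)) : ‖map u u' α β h‖ ≤ max ‖α‖ ‖β‖ :=
  (exists_map u u' α β h (le_max_left ‖α‖ ‖β‖) (le_max_right ‖α‖ ‖β‖)).choose_spec.1

@[simp]
theorem proj_map (u : Y →L[ℂ] Z) (u' : Y' →L[ℂ] Z') (α : Y →L[ℂ] Y')
    (β : Z →L[ℂ] Z') (h : ∀ y, β (u y) = u' (α y)) (s : InterpolationSpace u) :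
    proj u' (map u u' α β h s) = β (proj u s) :=
  (exists_map u u' α β h (le_max_left ‖α‖ ‖β‖) (le_max_right ‖α‖ ‖β‖)).choose_spec.2 s

/-- At level n the point is 2ⁿ u(p.1) + 2⁻ⁿ p.2 with ‖p‖ < ‖s‖ + 1, and the second term tends to 0.
Closed conditions on Z can therefore be checked on the range of u. -/
theorem proj_mem_closure (u : Y →L[ℂ] Z) (s : InterpolationSpace u) :
    proj u s ∈ closure (Set.range u) := by
  refine Metric.mem_closure_iff.2 fun ε hε => ?_
  obtain ⟨n, hn⟩ := exists_pow_lt_of_lt_one (show 0 < ε / (‖s‖ + 1) by positivity)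
    (show (1 / 2 : ℝ) < 1 by norm_num)
  obtain ⟨p, hp, hlt⟩ := exists_levelMap_eq u n (coord u s n) one_pos
  rw [levelEquiv_coord, levelMap_apply, ← map_smul] at hp
  refine ⟨_, ⟨(2 ^ n : ℂ) • p.1, rfl⟩, ?_⟩
  rw [dist_eq_norm, ← hp, add_sub_cancel_left, norm_smul, norm_inv, norm_pow, Complex.norm_ofNat,
    ← inv_pow, ← one_div]
  have h1 : ‖p.2‖ ≤ ‖s‖ + 1 := by
    have := lp.norm_apply_le_norm (p := 2) two_ne_zero (coord u s) n
    rw [norm_coord] at this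
    linarith [norm_snd_le p]
  calc (1 / 2 : ℝ) ^ n * ‖p.2‖ ≤ (1 / 2) ^ n * (‖s‖ + 1) := by gcongr
    _ < ε / (‖s‖ + 1) * (‖s‖ + 1) := by gcongr
    _ = ε := div_mul_cancel₀ _ (by positivity)

theorem norm_proj_le (u : Y →L[ℂ] Z) : ‖proj u‖ ≤ ‖u‖ + 1 := by
  refine ContinuousLinearMap.opNorm_le_bound _ (by positivity) fun s => ?_
  have h1 : ‖levelTo u 0‖ ≤ ‖u‖ + 1 := by
    refine (LinearMap.mkContinuous_norm_le _ (by positivity) _).trans_eq ?_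
    simp
  calc ‖levelTo u 0 (coord u s 0)‖ ≤ (‖u‖ + 1) * ‖coord u s 0‖ :=
        (levelTo u 0).le_of_opNorm_le h1 _
    _ ≤ (‖u‖ + 1) * ‖s‖ := by
        gcongr
        exact lp.norm_apply_le_norm (p := 2) two_ne_zero (coord u s) 0

/-- A closed condition that holds on the range of `u` holds on the interpolation space. -/
theorem proj_induction (u : Y →L[ℂ] Z) {q : Z → Prop} (hq : IsClosed {z | q z})
    (h : ∀ y, q (u y)) (s : InterpolationSpace u) : q (proj u s) :=
  closure_minimal (Set.range_subset_iff.2 h) hq (proj_mem_closure u s)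

/-- If the second adjoint of `u` takes its values in `Z`, then the interpolation space is
reflexive. -/
theorem isReflexiveSpace [CompleteSpace Z] (u : Y →L[ℂ] Z)
    (hu : ∀ η : StrongDual ℂ (StrongDual ℂ Y), ∃ z : Z, ∀ ζ : StrongDual ℂ Z,
      η (ζ.comp u) = ζ z) : IsReflexiveSpace (InterpolationSpace u) := by
  refine isReflexiveSpace_iff.2 fun η => ?_
  let θ : StrongDual ℂ (StrongDual ℂ Z) :=
    η.comp ((ContinuousLinearMap.compL ℂ (InterpolationSpace u) Z ℂ).flip (proj u))
  have hθ : ∀ ζ, θ ζ = η (ζ.comp (proj u)) := fun ζ => rfl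
  obtain ⟨z, hz⟩ : ∃ z : Z, ∀ ζ : StrongDual ℂ Z, θ ζ = ζ z := by
    refine exists_eq_of_bidual_approx θ fun ε hε => ?_
    obtain ⟨n, hn⟩ := exists_pow_lt_of_lt_one (show 0 < ε / (2 * ‖η‖ + 1) by positivity)
      (show (1 / 2 : ℝ) < 1 by norm_num)
    -- This is the adjoint of `levelMap u n`. It dominates θ, so θ = Θ ∘ g. One component of Θ lies
    -- in Y'' and becomes a point of Z by `hu`; the other contributes an error of order 2⁻ⁿ.
    let g : StrongDual ℂ Z →ₗ[ℂ] StrongDual ℂ Y × StrongDual ℂ Z :=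
      { toFun := fun ζ => ((2 ^ n : ℂ) • ζ.comp u, (2 ^ n : ℂ)⁻¹ • ζ)
        map_add' := fun ζ ζ' => by simp [ContinuousLinearMap.add_comp, smul_add]
        map_smul' := fun c ζ => by
          simp [ContinuousLinearMap.smul_comp, smul_comm c] }
    have hb : ∀ ζ, ‖θ ζ‖ ≤ (2 * ‖η‖) * ‖g ζ‖ := fun ζ => by
      rw [hθ, mul_comm 2, mul_assoc]
      refine (η.le_opNorm _).trans (mul_le_mul_of_nonneg_left ?_ (norm_nonneg _))
      refine ContinuousLinearMap.opNorm_le_bound _ (by positivity) fun s => ?_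
      refine le_of_forall_pos_le_add fun δ hδ => ?_
      -- Products carry the maximum norm, so pairing two pairs costs a factor 2.
      set M := 2 * ‖g ζ‖
      have hM : 0 ≤ M := by positivity
      obtain ⟨p, hp, hlt⟩ := exists_levelMap_eq u n (coord u s n) (ε := δ / (M + 1))
        (by positivity)
      rw [levelEquiv_coord] at hp
      have h1 : ζ (proj u s) = (g ζ).1 p.1 + (g ζ).2 p.2 := by
        rw [← hp, levelMap_apply, map_add, map_smul, map_smul]
        rfl
      have h2 : ‖ζ (proj u s)‖ ≤ M * ‖p‖ := by
        rw [h1]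
        refine (norm_add_le _ _).trans ?_
        have h3 := ((g ζ).1.le_opNorm p.1).trans
          (mul_le_mul (norm_fst_le (g ζ)) (norm_fst_le p) (norm_nonneg _) (norm_nonneg _))
        have h4 := ((g ζ).2.le_opNorm p.2).trans
          (mul_le_mul (norm_snd_le (g ζ)) (norm_snd_le p) (norm_nonneg _) (norm_nonneg _))
        calc _ ≤ ‖g ζ‖ * ‖p‖ + ‖g ζ‖ * ‖p‖ := add_le_add h3 h4
          _ = M * ‖p‖ := by simp only [M]; ring
      have h5 : ‖coord u s n‖ ≤ ‖s‖ := lp.norm_apply_le_norm (p := 2) two_ne_zero (coord u s) n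
      have h6 : M * (δ / (M + 1)) ≤ δ := by
        rw [mul_div_assoc', div_le_iff₀ (by positivity)]
        nlinarith
      calc ‖ζ (proj u s)‖ ≤ M * ‖p‖ := h2
        _ ≤ M * (‖s‖ + δ / (M + 1)) := by gcongr; linarith
        _ ≤ M * ‖s‖ + δ := by rw [mul_add]; linarith
    obtain ⟨Θ, hΘ, hΘg⟩ := exists_dual_comp_eq g θ.toLinearMap (by positivity) hb
    obtain ⟨z, hz⟩ := hu (Θ.comp (ContinuousLinearMap.inl ℂ _ _))
    refine ⟨(2 ^ n : ℂ) • z, fun ζ => ?_⟩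
    have h1 : θ ζ - ζ ((2 ^ n : ℂ) • z) = Θ (0, (2 ^ n : ℂ)⁻¹ • ζ) := by
      have h2 : g ζ = (2 ^ n : ℂ) • ContinuousLinearMap.inl ℂ _ (StrongDual ℂ Z) (ζ.comp u) +
          (0, (2 ^ n : ℂ)⁻¹ • ζ) := by
        simp only [ContinuousLinearMap.inl_apply, Prod.smul_mk, smul_zero, Prod.mk_add_mk,
          add_zero, zero_add]
        rfl
      have h3 := hΘg ζ
      rw [h2, map_add, map_smul] at h3
      rw [map_smul, ← hz ζ, sub_eq_iff_eq_add', ContinuousLinearMap.comp_apply]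
      exact h3.symm
    rw [h1]
    refine (Θ.le_of_opNorm_le hΘ _).trans ?_
    rw [Prod.norm_def, norm_zero, max_eq_right (norm_nonneg _), norm_smul, norm_inv, norm_pow,
      Complex.norm_ofNat, ← inv_pow, ← one_div, ← mul_assoc]
    gcongr
    calc 2 * ‖η‖ * (1 / 2) ^ n ≤ (2 * ‖η‖ + 1) * (ε / (2 * ‖η‖ + 1)) := by
          gcongr
          linarith
      _ = ε := mul_div_cancel₀ _ (by positivity)
  -- Every coordinate of η is a copy of the single point z, so the representing sequence is
  -- diagonal. Functionals on the diagonal extend to the whole ℓ²-sum by Hahn–Banach.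
  obtain ⟨h, hF⟩ := lp.bidual_eq_of_coordinates (coord u) (norm_coord_le u) η
    (fun n => levelOf u n z) fun n f => by
      have h1 : (f.comp (lp.evalCLM ℂ (Level u) 2 n)).comp (coord u) =
          (f.comp (levelOf u n)).comp (proj u) := by
        ext s
        change f (coord u s n) = f (levelOf u n (proj u s))
        rw [coord_apply]
      rw [h1, ← hθ, hz]
      rfl
  refine ⟨ofMem u z h, fun f => ?_⟩
  obtain ⟨F, -, hFf⟩ := exists_dual_comp_eq (coord u).toLinearMap f.toLinearMap (norm_nonneg f)
    fun s => f.le_opNorm s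
  have h1 : f = F.comp (coord u) := ContinuousLinearMap.ext fun s => (hFf s).symm
  rw [h1, hF]
  rfl

end InterpolationSpace

/-! ### The predual inside A' and weak*-continuity. -/

namespace DualBanachAlgebra

variable {A P : Type u} [NormedRing A] [NormedAlgebra ℂ A]
  [NormedAddCommGroup P] [NormedSpace ℂ P] [CompleteSpace P]

/-- The canonical isometric embedding of the predual into the dual. -/
noncomputable def predualEmbedding (D : DualBanachAlgebra A P) : P →ₗᵢ[ℂ] StrongDual ℂ A where
  toFun p := (NormedSpace.inclusionInDoubleDual ℂ P p).comp
    (D.toDual.toContinuousLinearEquiv : A →L[ℂ] StrongDual ℂ P)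
  map_add' p q := by ext; simp
  map_smul' c p := by ext; simp
  norm_map' p := by
    refine le_antisymm (ContinuousLinearMap.opNorm_le_bound _ (norm_nonneg _) fun a => ?_) ?_
    · change ‖D.toDual a p‖ ≤ _
      rw [mul_comm, ← D.toDual.norm_map a]
      exact (D.toDual a).le_opNorm p
    · refine NormedSpace.norm_le_dual_bound ℂ p (norm_nonneg _) fun f => ?_
      obtain ⟨a, rfl⟩ := D.toDual.surjective f
      rw [D.toDual.norm_map]
      exact ContinuousLinearMap.le_opNorm ((NormedSpace.inclusionInDoubleDual ℂ P p).comp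
        (D.toDual.toContinuousLinearEquiv : A →L[ℂ] StrongDual ℂ P)) a

/-- The weak*-continuous functionals of a dual Banach algebra. -/
noncomputable def predual (D : DualBanachAlgebra A P) : Submodule ℂ (StrongDual ℂ A) :=
  LinearMap.range D.predualEmbedding.toLinearMap

theorem isClosed_predual (D : DualBanachAlgebra A P) :
    IsClosed (D.predual : Set (StrongDual ℂ A)) := by
  have : (D.predual : Set (StrongDual ℂ A)) = Set.range D.predualEmbedding := rfl
  rw [this]
  exact D.predualEmbedding.isometry.isUniformInducing.isComplete_range.isClosed

theorem completeSpace (D : DualBanachAlgebra A P) : CompleteSpace A :=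
  (completeSpace_congr (e := D.toDual.toEquiv) D.toDual.isometry.isUniformEmbedding).2
    inferInstance

/-- Elements of the bidual act on the predual like elements of the algebra. -/
theorem exists_eq_of_bidual (D : DualBanachAlgebra A P) (η : StrongDual ℂ (StrongDual ℂ A)) :
    ∃ a : A, ∀ f ∈ D.predual, η f = f a := by
  obtain ⟨a, ha⟩ := D.toDual.surjective (η.comp D.predualEmbedding.toContinuousLinearMap)
  refine ⟨a, ?_⟩
  rintro _ ⟨p, rfl⟩
  change _ = D.toDual a p
  rw [ha]
  rfl

/-- The weak* topology is the initial topology of the functionals coming from P. A functional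
continuous for it is a finite linear combination of these, hence again one of them. -/
theorem continuous_weakStar_iff {D : DualBanachAlgebra A P} {f : StrongDual ℂ A} :
    Continuous[D.weakStar, inferInstance] f ↔ f ∈ D.predual := by
  let g : P → A →ₗ[ℂ] ℂ := fun p => (D.predualEmbedding p).toLinearMap
  have ht : D.weakStar = ⨅ p, TopologicalSpace.induced (g p) inferInstance := by
    rw [weakStar, weakStarTopology]
    have : (inferInstance : TopologicalSpace (WeakDual ℂ P)) =
        TopologicalSpace.induced (fun x y => x y) Pi.topologicalSpace := rfl
    rw [this, induced_compose, ← induced_to_pi]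
    rfl
  have h := LinearMap.mem_span_iff_continuous (f := g) f.toLinearMap
  rw [← ht] at h
  refine Iff.trans h.symm ⟨fun hf => ?_, fun ⟨p, hp⟩ => ?_⟩
  · have : Submodule.span ℂ (Set.range g) ≤
        D.predual.map (ContinuousLinearMap.coeLM ℂ : StrongDual ℂ A →ₗ[ℂ] A →ₗ[ℂ] ℂ) := by
      rw [Submodule.span_le]
      rintro _ ⟨p, rfl⟩
      exact ⟨_, ⟨p, rfl⟩, rfl⟩
    obtain ⟨f', hf', he⟩ := this hf
    have : f' = f := ContinuousLinearMap.coe_injective he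
    rwa [← this]
  · refine Submodule.subset_span ⟨p, ?_⟩
    rw [← hp]
    rfl

theorem comp_mul_right_mem_predual {D : DualBanachAlgebra A P} {f : StrongDual ℂ A}
    (hf : f ∈ D.predual) (c : A) :
    f.comp ((ContinuousLinearMap.mul ℂ A).flip c) ∈ D.predual := by
  rw [← continuous_weakStar_iff] at hf ⊢
  have h := @Continuous.comp _ _ _ D.weakStar D.weakStar _ _ _ hf (D.continuous_mul_right c)
  exact h

theorem weakStarContinuous_iff {D : DualBanachAlgebra A P} {X : Type u} [NormedAddCommGroup X]
    [NormedSpace ℂ X] (f : A →L[ℂ] StrongDual ℂ X) :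
    D.WeakStarContinuous f ↔ ∀ x, f.flip x ∈ D.predual := by
  simp_rw [← continuous_weakStar_iff]
  constructor
  · intro h x
    have h' := @Continuous.comp _ _ _ D.weakStar _ _ _ _ (WeakDual.eval_continuous x) h
    exact h'
  · intro h
    exact @WeakDual.continuous_of_continuous_eval _ _ _ _ _ _ _ _ _ _ D.weakStar _ h

/-- Continuity into X' is tested at each x, so normality becomes membership of coefficient
functionals in a closed subspace of A', stable under norm limits. -/
theorem isNormal_iff {D : DualBanachAlgebra A P} {X : Type u} [NormedAddCommGroup X]
    [NormedSpace ℂ X] (M : BanachBimodule A X) :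
    D.IsNormal M ↔ ∀ (φ : StrongDual ℂ X) (x : X),
      φ.comp (M.right.flip x) ∈ D.predual ∧ φ.comp (M.left.flip x) ∈ D.predual := by
  have hl : ∀ φ : StrongDual ℂ X, (fun a => M.dualLeft a φ) =
      (ContinuousLinearMap.compL ℂ X X ℂ φ).comp M.right := fun φ => rfl
  have hr : ∀ φ : StrongDual ℂ X, (fun a => M.dualRight φ a) =
      (ContinuousLinearMap.compL ℂ X X ℂ φ).comp M.left := fun φ => rfl
  refine forall_congr' fun φ => ?_
  rw [hl, hr, weakStarContinuous_iff, weakStarContinuous_iff, ← forall_and]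
  rfl

/-- A unital Banach left module over a dual Banach algebra with weak*-continuous coefficient
functionals. -/
structure NormalModule (D : DualBanachAlgebra A P) (E : Type u) [NormedAddCommGroup E]
    [NormedSpace ℂ E] where
  /-- the action -/
  act : A →L[ℂ] E →L[ℂ] E
  act_one : ∀ x, act 1 x = x
  act_mul : ∀ a b x, act (a * b) x = act a (act b x)
  normal : ∀ (μ : StrongDual ℂ E) (x : E), μ.comp (act.flip x) ∈ D.predual

/-! ### Normal modules: products, ℓ²-sums and interpolation spaces. -/

namespace NormalModule

variable {D : DualBanachAlgebra A P} {E F : Type u} [NormedAddCommGroup E] [NormedSpace ℂ E]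
  [NormedAddCommGroup F] [NormedSpace ℂ F]

/-- The representation given by a module. -/
noncomputable def toAlgHom (M : NormalModule D E) : A →ₐ[ℂ] (E →L[ℂ] E) :=
  AlgHom.ofLinearMap M.act.toLinearMap (ContinuousLinearMap.ext M.act_one)
    fun a b => ContinuousLinearMap.ext (M.act_mul a b)

/-- An element of the projective tensor product gives a norm-convergent series of coefficient
functionals, and the predual is norm closed. -/
theorem continuous_toAlgHom (M : NormalModule D E) :
    Continuous[D.weakStar, operatorWeakStarTopology E] M.toAlgHom := by
  refine continuous_induced_rng.2 ?_
  refine (@continuous_pi_iff _ _ _ D.weakStar _ _).2 fun τ => ?_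
  let g : ℕ → StrongDual ℂ A := fun n => (τ.1.1 n).comp (M.act.flip (τ.1.2 n))
  have hg : Summable g := by
    refine Summable.of_norm_bounded (τ.2.mul_left ‖M.act‖) fun n => ?_
    refine ContinuousLinearMap.opNorm_le_bound _ (by positivity) fun a => ?_
    calc ‖τ.1.1 n (M.act a (τ.1.2 n))‖ ≤ ‖τ.1.1 n‖ * (‖M.act a‖ * ‖τ.1.2 n‖) :=
          (τ.1.1 n).le_opNorm_of_le ((M.act a).le_opNorm _)
      _ ≤ ‖τ.1.1 n‖ * ((‖M.act‖ * ‖a‖) * ‖τ.1.2 n‖) := by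
          gcongr
          exact M.act.le_opNorm a
      _ = _ := by ring
  have hmem : (∑' n, g n) ∈ D.predual :=
    D.isClosed_predual.mem_of_tendsto hg.hasSum
      (Filter.Eventually.of_forall fun s => D.predual.sum_mem fun n _ => M.normal _ _)
  have heq : (fun a => ∑' n, τ.1.1 n (M.toAlgHom a (τ.1.2 n))) = ⇑(∑' n, g n) := by
    funext a
    exact ((ContinuousLinearMap.apply ℂ ℂ a).map_tsum hg).symm
  have := continuous_weakStar_iff.2 hmem
  rw [← heq] at this
  exact this

/-- The product of two modules. -/
noncomputable def prod (M : NormalModule D E) (N : NormalModule D F) : NormalModule D (E × F) where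
  act := LinearMap.mkContinuous
    { toFun := fun a => (M.act a).prodMap (N.act a)
      map_add' := fun a b => by ext <;> simp
      map_smul' := fun c a => by ext <;> simp } (max ‖M.act‖ ‖N.act‖) fun a => by
    refine ContinuousLinearMap.opNorm_le_bound _ (by positivity) fun x => ?_
    refine max_le ?_ ?_
    · calc ‖M.act a x.1‖ ≤ ‖M.act‖ * ‖a‖ * ‖x.1‖ := M.act.le_opNorm₂ a x.1
        _ ≤ _ := by
          gcongr
          · exact le_max_left _ _
          · exact norm_fst_le x
    · calc ‖N.act a x.2‖ ≤ ‖N.act‖ * ‖a‖ * ‖x.2‖ := N.act.le_opNorm₂ a x.2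
        _ ≤ _ := by
          gcongr
          · exact le_max_right _ _
          · exact norm_snd_le x
  act_one x := Prod.ext (M.act_one _) (N.act_one _)
  act_mul a b x := Prod.ext (M.act_mul _ _ _) (N.act_mul _ _ _)
  normal μ x := by
    have := D.predual.add_mem (M.normal (μ.comp (ContinuousLinearMap.inl ℂ E F)) x.1)
      (N.normal (μ.comp (ContinuousLinearMap.inr ℂ E F)) x.2)
    convert this using 1
    ext a
    change μ (M.act a x.1, N.act a x.2) = μ (M.act a x.1, 0) + μ (0, N.act a x.2)
    rw [← map_add, Prod.mk_add_mk, add_zero, zero_add]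

theorem prod_act (M : NormalModule D E) (N : NormalModule D F) (a : A) (x : E × F) :
    (M.prod N).act a x = (M.act a x.1, N.act a x.2) := rfl

/-- The diagonal action on an `ℓ²`-sum. -/
noncomputable def lpAct {ι : Type u} {E : ι → Type u} [∀ i, NormedAddCommGroup (E i)]
    [∀ i, NormedSpace ℂ (E i)] (act : ∀ i, A →L[ℂ] E i →L[ℂ] E i) {C : ℝ} (hC : 0 ≤ C)
    (h : ∀ i, ‖act i‖ ≤ C) : A →L[ℂ] lp E 2 →L[ℂ] lp E 2 :=
  LinearMap.mkContinuous
    { toFun := fun a => lp.mapCLM 2 (fun i => act i a) (K := C * ‖a‖) (by positivity)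
        fun i => (act i).le_of_opNorm_le (h i) a
      map_add' := fun a b => by ext; simp
      map_smul' := fun c a => by ext; simp } C
    fun a => lp.norm_mapCLM_le 2 (fun i => act i a) (by positivity)
      fun i => (act i).le_of_opNorm_le (h i) a

/-- The `ℓ²`-sum of a uniformly bounded family of modules. -/
noncomputable def lpSum {ι : Type u} {E : ι → Type u} [∀ i, NormedAddCommGroup (E i)]
    [∀ i, NormedSpace ℂ (E i)] (M : ∀ i, NormalModule D (E i)) {C : ℝ} (hC : 0 ≤ C)
    (hM : ∀ i, ‖(M i).act‖ ≤ C) : NormalModule D (lp E 2) where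
  act := lpAct (fun i => (M i).act) hC hM
  act_one x := lp.ext (funext fun i => (M i).act_one _)
  act_mul a b x := lp.ext (funext fun i => (M i).act_mul _ _ _)
  normal μ x := by
    classical
    let L : lp E 2 →L[ℂ] StrongDual ℂ A := (ContinuousLinearMap.compL ℂ A (lp E 2) ℂ μ).comp
      (lpAct (fun i => (M i).act) hC hM).flip
    have hL : HasSum (fun i => L (lp.single 2 i (x i))) (L x) :=
      (lp.hasSum_single (p := 2) (by simp) x).mapL L
    refine D.isClosed_predual.mem_of_tendsto hL
      (Filter.Eventually.of_forall fun s => D.predual.sum_mem fun i _ => ?_)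
    convert (M i).normal (μ.comp (lp.singleContinuousLinearMap ℂ E 2 i)) (x i) using 1
    ext a
    refine congrArg μ (lp.ext (funext fun j => ?_))
    change (M j).act a (lp.single 2 i (x i) j) = lp.single 2 i ((M i).act a (x i)) j
    rcases eq_or_ne j i with rfl | hne
    · rw [lp.single_apply_self, lp.single_apply_self]
    · rw [lp.single_apply_ne _ _ _ hne, lp.single_apply_ne _ _ _ hne, map_zero]

theorem lpSum_act {ι : Type u} {E : ι → Type u} [∀ i, NormedAddCommGroup (E i)]
    [∀ i, NormedSpace ℂ (E i)] (M : ∀ i, NormalModule D (E i)) {C : ℝ} (hC : 0 ≤ C)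
    (hM : ∀ i, ‖(M i).act‖ ≤ C) (a : A) (x : lp E 2) (i : ι) :
    (lpSum M hC hM).act a x i = (M i).act a (x i) := rfl

/-- A module structure on an interpolation space. -/
theorem exists_interpolation {Y Z : Type u} [NormedAddCommGroup Y] [NormedSpace ℂ Y]
    [NormedAddCommGroup Z] [NormedSpace ℂ Z] (u : Y →L[ℂ] Z)
    (hE : IsReflexiveSpace (InterpolationSpace u)) (α : A →L[ℂ] Y →L[ℂ] Y)
    (β : A →L[ℂ] Z →L[ℂ] Z) (hβ1 : ∀ z, β 1 z = z) (hβm : ∀ a b z, β (a * b) z = β a (β b z))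
    (hu : ∀ a y, β a (u y) = u (α a y))
    (hn : ∀ (ζ : StrongDual ℂ Z) (y : Y), ζ.comp (β.flip (u y)) ∈ D.predual) :
    ∃ M : NormalModule D (InterpolationSpace u), ‖M.act‖ ≤ max ‖α‖ ‖β‖ ∧
      ∀ a s, InterpolationSpace.proj u (M.act a s) = β a (InterpolationSpace.proj u s) := by
  have hbd : ∀ a, ‖InterpolationSpace.map u u (α a) (β a) (hu a)‖ ≤ max ‖α‖ ‖β‖ * ‖a‖ := fun a => by
    refine (InterpolationSpace.norm_map_le u u (α a) (β a) (hu a)).trans (max_le ?_ ?_)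
    · exact (α.le_opNorm a).trans (mul_le_mul_of_nonneg_right (le_max_left _ _) (norm_nonneg _))
    · exact (β.le_opNorm a).trans (mul_le_mul_of_nonneg_right (le_max_right _ _) (norm_nonneg _))
  let act : A →L[ℂ] InterpolationSpace u →L[ℂ] InterpolationSpace u := LinearMap.mkContinuous
    { toFun := fun a => InterpolationSpace.map u u (α a) (β a) (hu a)
      map_add' := fun a b => ContinuousLinearMap.ext fun s =>
        InterpolationSpace.proj_injective u (by simp)
      map_smul' := fun c a => ContinuousLinearMap.ext fun s =>
        InterpolationSpace.proj_injective u (by simp) } (max ‖α‖ ‖β‖) hbd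
  have hact : ∀ a s, InterpolationSpace.proj u (act a s) = β a (InterpolationSpace.proj u s) :=
    fun a s => InterpolationSpace.proj_map u u (α a) (β a) (hu a) s
  refine ⟨⟨act, fun s => InterpolationSpace.proj_injective u (by rw [hact, hβ1]),
    fun a b s => InterpolationSpace.proj_injective u (by rw [hact, hact, hact, hβm]), ?_⟩,
    LinearMap.mkContinuous_norm_le _ (by positivity) hbd, hact⟩
  intro μ s
  -- The functionals μ with coefficient in the predual form a closed subspace, so a dense set
  -- suffices. The functionals ζ ∘ `proj` separate points, hence are dense by reflexivity; for them
  -- the condition passes from the range of u to its closure.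
  let L : StrongDual ℂ (InterpolationSpace u) →L[ℂ] StrongDual ℂ A :=
    (ContinuousLinearMap.compL ℂ A (InterpolationSpace u) ℂ).flip (act.flip s)
  let S : Submodule ℂ (StrongDual ℂ (InterpolationSpace u)) := D.predual.comap L.toLinearMap
  let S₀ : Submodule ℂ (StrongDual ℂ (InterpolationSpace u)) :=
    LinearMap.range ((ContinuousLinearMap.compL ℂ (InterpolationSpace u) Z ℂ).flip
      (InterpolationSpace.proj u)).toLinearMap
  have hS : IsClosed (S : Set (StrongDual ℂ (InterpolationSpace u))) :=
    D.isClosed_predual.preimage L.continuous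
  have hS₀ : S₀ ≤ S := by
    rintro _ ⟨ζ, rfl⟩
    let L' : Z →L[ℂ] StrongDual ℂ A := (ContinuousLinearMap.compL ℂ A Z ℂ ζ).comp β.flip
    have h1 : L' (InterpolationSpace.proj u s) ∈ D.predual :=
      InterpolationSpace.proj_induction u (q := fun z => L' z ∈ D.predual)
        (D.isClosed_predual.preimage L'.continuous) (fun y => hn ζ y) s
    have h2 : L (ζ.comp (InterpolationSpace.proj u)) = L' (InterpolationSpace.proj u s) := by
      ext a
      exact congrArg ζ (hact a s)
    change L (ζ.comp (InterpolationSpace.proj u)) ∈ D.predual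
    rwa [h2]
  have htop : S₀.topologicalClosure = ⊤ := hE.topologicalClosure_eq_top S₀ fun e he => by
    refine InterpolationSpace.proj_injective u ?_
    rw [map_zero]
    exact SeparatingDual.eq_zero_of_forall_dual_eq_zero (R := ℂ)
      fun ζ => he _ ⟨ζ, rfl⟩
  have : μ ∈ S := S₀.topologicalClosure_minimal hS₀ hS (htop ▸ Submodule.mem_top)
  exact this

end NormalModule

/-! ### From quasi-expectations to projections onto module maps. -/

theorem isReflexiveSpace_prod {E F : Type u} [NormedAddCommGroup E] [NormedSpace ℂ E]
    [NormedAddCommGroup F] [NormedSpace ℂ F] (hE : IsReflexiveSpace E) (hF : IsReflexiveSpace F) :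
    IsReflexiveSpace (E × F) := by
  rw [isReflexiveSpace_iff] at hE hF ⊢
  intro η
  obtain ⟨x, hx⟩ := hE (η.comp ((ContinuousLinearMap.compL ℂ (E × F) E ℂ).flip
    (ContinuousLinearMap.fst ℂ E F)))
  obtain ⟨y, hy⟩ := hF (η.comp ((ContinuousLinearMap.compL ℂ (E × F) F ℂ).flip
    (ContinuousLinearMap.snd ℂ E F)))
  refine ⟨(x, y), fun f => ?_⟩
  have h1 := hx (f.comp (ContinuousLinearMap.inl ℂ E F))
  have h2 := hy (f.comp (ContinuousLinearMap.inr ℂ E F))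
  have h3 : f = (f.comp (ContinuousLinearMap.inl ℂ E F)).comp (ContinuousLinearMap.fst ℂ E F) +
      (f.comp (ContinuousLinearMap.inr ℂ E F)).comp (ContinuousLinearMap.snd ℂ E F) := by
    ext <;> simp [Prod.mk_zero_zero]
  have h4 : f (x, y) = f.comp (ContinuousLinearMap.inl ℂ E F) x +
      f.comp (ContinuousLinearMap.inr ℂ E F) y := by
    conv_lhs => rw [h3]
    simp
  rw [h4, ← h1, ← h2]
  conv_lhs => rw [h3]
  rw [map_add]
  rfl

/-- For an injective algebra, the module maps between reflexive modules are complemented in a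
bimodular way. -/
theorem Injective.exists_hom_projection {D : DualBanachAlgebra A P} (hD : D.Injective)
    {E F : Type u} [NormedAddCommGroup E] [NormedSpace ℂ E] [CompleteSpace E]
    [NormedAddCommGroup F] [NormedSpace ℂ F] [CompleteSpace F]
    (hE : IsReflexiveSpace E) (hF : IsReflexiveSpace F) (M : NormalModule D E)
    (N : NormalModule D F) :
    ∃ Q : (E →L[ℂ] F) →L[ℂ] (E →L[ℂ] F),
      (∀ T a x, Q T (M.act a x) = N.act a (Q T x)) ∧
      (∀ T : E →L[ℂ] F, (∀ a x, T (M.act a x) = N.act a (T x)) → Q T = T) ∧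
      (∀ (R : F →L[ℂ] F) (S : E →L[ℂ] E), (∀ a x, R (N.act a x) = N.act a (R x)) →
        (∀ a x, S (M.act a x) = M.act a (S x)) → ∀ T, Q (R.comp (T.comp S)) =
          R.comp ((Q T).comp S)) := by
  -- Operators from E to F form an off-diagonal corner of B(E × F). Module endomorphisms of E and F
  -- lie in the commutant as diagonal corners, so the bimodule property of Q₀ becomes compatibility
  -- with composition.
  obtain ⟨Q₀, hQ₀⟩ := hD (E × F) (isReflexiveSpace_prod hE hF) (M.prod N).toAlgHom
    (M.prod N).continuous_toAlgHom
  let inE := ContinuousLinearMap.inl ℂ E F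
  let inF := ContinuousLinearMap.inr ℂ E F
  let outE := ContinuousLinearMap.fst ℂ E F
  let outF := ContinuousLinearMap.snd ℂ E F
  have hmem : ∀ T : E × F →L[ℂ] E × F, T ∈ Set.centralizer (Set.range (M.prod N).toAlgHom) ↔
      ∀ a x, T ((M.prod N).act a x) = (M.prod N).act a (T x) := by
    intro T
    simp only [Set.mem_centralizer_iff, Set.forall_mem_range, ContinuousLinearMap.ext_iff]
    exact forall_congr' fun a => forall_congr' fun x => eq_comm
  let up : (E →L[ℂ] F) →L[ℂ] (E × F →L[ℂ] E × F) :=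
    (ContinuousLinearMap.compL ℂ (E × F) F (E × F) inF).comp
      ((ContinuousLinearMap.compL ℂ (E × F) E F).flip outE)
  let down : (E × F →L[ℂ] E × F) →L[ℂ] (E →L[ℂ] F) :=
    (ContinuousLinearMap.compL ℂ E (E × F) F outF).comp
      ((ContinuousLinearMap.compL ℂ E (E × F) (E × F)).flip inE)
  have hup : ∀ T x, up T x = (0, T x.1) := fun T x => rfl
  have hdown : ∀ T x, down T x = (T (x, 0)).2 := fun T x => rfl
  refine ⟨down.comp (Q₀.comp up), fun T a x => ?_, fun T hT => ?_, fun R S hR hS T => ?_⟩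
  · have h := (hmem _).1 (hQ₀.mem_commutant (up T)) a (x, 0)
    have h1 : (M.prod N).act a (x, 0) = (M.act a x, 0) := by
      rw [NormalModule.prod_act, map_zero]
    rw [h1] at h
    exact congrArg Prod.snd h
  · have h : Q₀ (up T) = up T := hQ₀.apply_of_mem _ ((hmem _).2 fun a x => by
      rw [hup, hup, NormalModule.prod_act, NormalModule.prod_act, hT, map_zero])
    ext x
    change down (Q₀ (up T)) x = T x
    rw [h]
    rfl
  · have hc : inF.comp (R.comp outF) ∈ Set.centralizer (Set.range (M.prod N).toAlgHom) :=
      (hmem _).2 fun a x => by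
        change (0, R (N.act a x.2)) = (M.act a 0, N.act a (R x.2))
        rw [hR, map_zero]
    have hd : inE.comp (S.comp outE) ∈ Set.centralizer (Set.range (M.prod N).toAlgHom) :=
      (hmem _).2 fun a x => by
        change (S (M.act a x.1), 0) = (M.act a (S x.1), N.act a 0)
        rw [hS, map_zero]
    have h := hQ₀.map_mul_mul _ hc _ hd (up T)
    have h1 : inF.comp (R.comp outF) * up T * inE.comp (S.comp outE) =
        up (R.comp (T.comp S)) := rfl
    rw [h1] at h
    change down (Q₀ (up (R.comp (T.comp S)))) = _
    rw [h]
    rfl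

end DualBanachAlgebra

section

set_option maxSynthPendingDepth 3

namespace DualBanachAlgebra

variable {A P : Type u} [NormedRing A] [NormedAlgebra ℂ A]
  [NormedAddCommGroup P] [NormedSpace ℂ P] [CompleteSpace P]

/-! ### Translations, orbit maps and their reflexive models. -/

section Translation

variable (A) (V : Type*) [NormedAddCommGroup V] [NormedSpace ℂ V]

/-- The left action `(a • g) b = g (b a)` on operators defined on the algebra. -/
noncomputable def translate : A →L[ℂ] (A →L[ℂ] V) →L[ℂ] (A →L[ℂ] V) :=
  (ContinuousLinearMap.compL ℂ A A V).flip.comp (ContinuousLinearMap.mul ℂ A).flip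

variable {A V}

@[simp]
theorem translate_apply (a : A) (g : A →L[ℂ] V) (b : A) : translate A V a g b = g (b * a) := rfl

variable (A V)

theorem norm_translate_le : ‖translate A V‖ ≤ 1 := by
  refine ContinuousLinearMap.opNorm_le_bound _ zero_le_one fun a => ?_
  refine ContinuousLinearMap.opNorm_le_bound _ (by positivity) fun g => ?_
  refine ContinuousLinearMap.opNorm_le_bound _ (by positivity) fun b => ?_
  calc ‖g (b * a)‖ ≤ ‖g‖ * (‖b‖ * ‖a‖) := g.le_opNorm_of_le (norm_mul_le b a)
    _ = 1 * ‖a‖ * ‖g‖ * ‖b‖ := by ring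

theorem translate_one (g : A →L[ℂ] V) : translate A V 1 g = g := by
  ext b; simp

theorem translate_mul (a b : A) (g : A →L[ℂ] V) :
    translate A V (a * b) g = translate A V a (translate A V b g) := by
  ext c; simp [mul_assoc]

variable {A V}

/-- The orbit map `b ↦ b • h` of an operator on the algebra. -/
noncomputable def orbit (h : A →L[ℂ] V) : A →L[ℂ] A →L[ℂ] V :=
  (translate A V).flip h

@[simp]
theorem orbit_apply (h : A →L[ℂ] V) (b c : A) : orbit h b c = h (c * b) := rfl

theorem translate_orbit (h : A →L[ℂ] V) (a b : A) :
    translate A V a (orbit h b) = orbit h (a * b) := by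
  ext c; simp [mul_assoc]

end Translation

section OrbitModule

variable {V : Type u} [NormedAddCommGroup V] [NormedSpace ℂ V]

/-- By `hh`, an element of A'' meets only functionals in the predual, where it acts as some a in A.
The second adjoint therefore takes the value `orbit h a`. -/
theorem isReflexiveSpace_orbit [CompleteSpace V] {D : DualBanachAlgebra A P} (h : A →L[ℂ] V)
    (hh : ∀ ζ : StrongDual ℂ (A →L[ℂ] V), ζ.comp (orbit h) ∈ D.predual) :
    IsReflexiveSpace (InterpolationSpace (orbit h)) := by
  refine InterpolationSpace.isReflexiveSpace _ fun η => ?_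
  obtain ⟨a, ha⟩ := D.exists_eq_of_bidual η
  exact ⟨orbit h a, fun ζ => ha _ (hh ζ)⟩

theorem exists_module_orbit [CompleteSpace V] {D : DualBanachAlgebra A P} (h : A →L[ℂ] V)
    (hh : ∀ ζ : StrongDual ℂ (A →L[ℂ] V), ζ.comp (orbit h) ∈ D.predual) :
    ∃ M : NormalModule D (InterpolationSpace (orbit h)), ‖M.act‖ ≤ 1 ∧
      ∀ a s, InterpolationSpace.proj (orbit h) (M.act a s) =
        translate A V a (InterpolationSpace.proj (orbit h) s) := by
  obtain ⟨M, hM, hM'⟩ := NormalModule.exists_interpolation (D := D) (orbit h)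
    (isReflexiveSpace_orbit h hh) (ContinuousLinearMap.mul ℂ A) (translate A V)
    (translate_one A V) (translate_mul A V) (translate_orbit h) fun ζ b => by
      convert comp_mul_right_mem_predual (hh ζ) b using 1
      ext a
      exact congrArg ζ (translate_orbit h a b)
  exact ⟨M, hM.trans (max_le (ContinuousLinearMap.opNorm_mul_le ℂ A) (norm_translate_le A V)), hM'⟩

end OrbitModule

/-! ### Reflexive models of X' over finite-dimensional subspaces of X. -/

section FiniteDimensional

theorem clm_eq_sum_basis {K V ι : Type*} [NormedAddCommGroup K] [NormedSpace ℂ K]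
    [FiniteDimensional ℂ K] [NormedAddCommGroup V] [NormedSpace ℂ V] [Fintype ι]
    (e : Module.Basis ι ℂ K) (w : K →L[ℂ] V) :
    w = ∑ i, ((e.coord i).toContinuousLinearMap).smulRight (w (e i)) := by
  ext κ
  conv_lhs => rw [← e.sum_repr κ, map_sum]
  simp

variable {X K : Type u} [NormedAddCommGroup X] [NormedSpace ℂ X] [NormedAddCommGroup K]
  [NormedSpace ℂ K]

/-- The operator `φ ↦ (κ ↦ (a ↦ ⟨φ, k(κ) · a⟩))`. -/
noncomputable def coefficient (M : BanachBimodule A X) (k : K →L[ℂ] X) :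
    StrongDual ℂ X →L[ℂ] (K →L[ℂ] StrongDual ℂ A) :=
  ((ContinuousLinearMap.compL ℂ K (A →L[ℂ] X) (A →L[ℂ] ℂ)).flip (M.right.flip.comp k)).comp
    (ContinuousLinearMap.compL ℂ A X ℂ)

@[simp]
theorem coefficient_apply (M : BanachBimodule A X) (k : K →L[ℂ] X) (φ : StrongDual ℂ X) (κ : K)
    (a : A) : coefficient M k φ κ a = φ (M.right a (k κ)) := rfl

theorem norm_coefficient_le (M : BanachBimodule A X) (k : K →L[ℂ] X) (hk : ‖k‖ ≤ 1) :
    ‖coefficient M k‖ ≤ ‖M.right‖ := by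
  refine ContinuousLinearMap.opNorm_le_bound _ (norm_nonneg _) fun φ => ?_
  refine ContinuousLinearMap.opNorm_le_bound _ (by positivity) fun κ => ?_
  refine ContinuousLinearMap.opNorm_le_bound _ (by positivity) fun a => ?_
  calc ‖φ (M.right a (k κ))‖ ≤ ‖φ‖ * (‖M.right‖ * ‖a‖ * ‖k κ‖) :=
        φ.le_opNorm_of_le (M.right.le_opNorm₂ a _)
    _ ≤ ‖φ‖ * (‖M.right‖ * ‖a‖ * (1 * ‖κ‖)) := by
        gcongr
        exact k.le_of_opNorm_le hk κ
    _ = ‖M.right‖ * ‖φ‖ * ‖κ‖ * ‖a‖ := by ring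

variable (A K) in
/-- The action on `K → A'` by translation. -/
noncomputable def pointwiseTranslate :
    A →L[ℂ] (K →L[ℂ] StrongDual ℂ A) →L[ℂ] (K →L[ℂ] StrongDual ℂ A) :=
  (ContinuousLinearMap.compL ℂ K (StrongDual ℂ A) (StrongDual ℂ A)).comp (translate A ℂ)

@[simp]
theorem pointwiseTranslate_apply (c : A) (w : K →L[ℂ] StrongDual ℂ A) (κ : K) (a : A) :
    pointwiseTranslate A K c w κ a = w κ (a * c) := rfl

variable (A K) in
theorem norm_pointwiseTranslate_le : ‖pointwiseTranslate A K‖ ≤ 1 := by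
  refine (ContinuousLinearMap.opNorm_comp_le _ _).trans ?_
  exact mul_le_one₀ (ContinuousLinearMap.norm_compL_le ℂ _ _ _) (norm_nonneg _)
    (norm_translate_le A ℂ)

theorem pointwiseTranslate_coefficient (M : BanachBimodule A X) (k : K →L[ℂ] X) (c : A)
    (φ : StrongDual ℂ X) :
    pointwiseTranslate A K c (coefficient M k φ) = coefficient M k (M.dualLeft c φ) := by
  ext κ a
  simp [M.right_mul, BanachBimodule.dualLeft]

variable {D : DualBanachAlgebra A P}

/-- In a basis e of K, ζ splits into finitely many elements of A''. By normality they only meet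
predual functionals, so they act as elements aᵢ of A, and x = ∑ k(eᵢ)·aᵢ. Finite dimension is what
produces a point of X. -/
theorem exists_dual_comp_coefficient_eq [FiniteDimensional ℂ K] {M : BanachBimodule A X}
    (hM : D.IsNormal M) (k : K →L[ℂ] X) (ζ : StrongDual ℂ (K →L[ℂ] StrongDual ℂ A)) :
    ∃ x : X, ∀ φ, ζ (coefficient M k φ) = φ x := by
  let e := Module.finBasis ℂ K
  rw [isNormal_iff] at hM
  choose a ha using fun i => D.exists_eq_of_bidual
    (ζ.comp (ContinuousLinearMap.smulRightL ℂ K (StrongDual ℂ A)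
      (e.coord i).toContinuousLinearMap))
  refine ⟨∑ i, M.right (a i) (k (e i)), fun φ => ?_⟩
  rw [clm_eq_sum_basis e (coefficient M k φ), map_sum, map_sum]
  exact Finset.sum_congr rfl fun i _ => ha i _ (hM φ (k (e i))).1

/-- Functionals pull back to evaluations at points of X, so an element of X''' acts through its
restriction ψ to X, and the second adjoint takes the value `coefficient M k ψ`. -/
theorem isReflexiveSpace_coefficient [FiniteDimensional ℂ K] [CompleteSpace K]
    {M : BanachBimodule A X}
    (hM : D.IsNormal M) (k : K →L[ℂ] X) :
    IsReflexiveSpace (InterpolationSpace (coefficient M k)) := by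
  refine InterpolationSpace.isReflexiveSpace _ fun η => ?_
  let ψ : StrongDual ℂ X := η.comp (NormedSpace.inclusionInDoubleDual ℂ X)
  refine ⟨coefficient M k ψ, fun ζ => ?_⟩
  obtain ⟨x, hx⟩ := exists_dual_comp_coefficient_eq hM k ζ
  have : ζ.comp (coefficient M k) = NormedSpace.inclusionInDoubleDual ℂ X x :=
    ContinuousLinearMap.ext hx
  rw [this, hx]
  rfl

theorem exists_module_coefficient [FiniteDimensional ℂ K] [CompleteSpace K]
    {M : BanachBimodule A X} (hM : D.IsNormal M) (k : K →L[ℂ] X) :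
    ∃ N : NormalModule D (InterpolationSpace (coefficient M k)), ‖N.act‖ ≤ max ‖M.right‖ 1 ∧
      ∀ a s, InterpolationSpace.proj (coefficient M k) (N.act a s) =
        pointwiseTranslate A K a (InterpolationSpace.proj (coefficient M k) s) := by
  let α : A →L[ℂ] StrongDual ℂ X →L[ℂ] StrongDual ℂ X :=
    (ContinuousLinearMap.compL ℂ X X ℂ).flip.comp M.right
  have hα : ‖α‖ ≤ ‖M.right‖ := by
    refine (ContinuousLinearMap.opNorm_comp_le _ _).trans ?_
    refine mul_le_of_le_one_left (norm_nonneg _) ?_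
    rw [ContinuousLinearMap.opNorm_flip]
    exact ContinuousLinearMap.norm_compL_le ℂ _ _ _
  obtain ⟨N, hN, hN'⟩ := NormalModule.exists_interpolation (D := D) (coefficient M k)
    (isReflexiveSpace_coefficient hM k) α (pointwiseTranslate A K)
    (fun w => by ext; simp) (fun a b w => by ext; simp [mul_assoc])
    (pointwiseTranslate_coefficient M k) fun ζ φ => by
      obtain ⟨x, hx⟩ := exists_dual_comp_coefficient_eq hM k ζ
      convert ((isNormal_iff M).1 hM φ x).1 using 1
      ext a
      have := hx (M.dualLeft a φ)
      rw [← pointwiseTranslate_coefficient] at this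
      exact this
  exact ⟨N, hN.trans (max_le_max hα (norm_pointwiseTranslate_le A K)), hN'⟩

end FiniteDimensional

/-! ### Weak*-continuity of the orbit of a derivation. -/

section Derivation

variable {X K : Type u} [NormedAddCommGroup X] [NormedSpace ℂ X] [NormedAddCommGroup K]
  [NormedSpace ℂ K] {D : DualBanachAlgebra A P}

/-- The operator `(a, φ) ↦ ⟨φ, x · a⟩` as a function of `x`. -/
noncomputable def orbitDual (M : BanachBimodule A X) :
    X →L[ℂ] StrongDual ℂ X →L[ℂ] StrongDual ℂ A :=
  (ContinuousLinearMap.compL ℂ A X ℂ).flip.comp M.right.flip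

@[simp]
theorem orbitDual_apply (M : BanachBimodule A X) (x : X) (φ : StrongDual ℂ X) (a : A) :
    orbitDual M x φ a = φ (M.right a x) := rfl

/-- The derivation law splits d(b'b) into b'·d(b) and d(b')·b. On the first part ζ acts as some a in
A and leaves b ↦ d(b)(x·a), handled by weak*-continuity of d. The second leaves b ↦ ψ(b·x), handled
by normality. -/
theorem comp_orbit_orbitDual_mem_predual {M : BanachBimodule A X} (hM : D.IsNormal M)
    {d : A →L[ℂ] StrongDual ℂ X}
    (hd : ∀ a b : A, d (a * b) = M.dualLeft a (d b) + M.dualRight (d a) b)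
    (hdw : D.WeakStarContinuous d) (x : X) (ζ : StrongDual ℂ (A →L[ℂ] StrongDual ℂ A)) :
    ζ.comp (orbit ((orbitDual M x).comp d)) ∈ D.predual := by
  rw [weakStarContinuous_iff] at hdw
  rw [isNormal_iff] at hM
  obtain ⟨a, ha⟩ := D.exists_eq_of_bidual (ζ.comp (translate A ℂ).flip)
  let ψ : StrongDual ℂ X := ζ.comp
    (((ContinuousLinearMap.compL ℂ A (StrongDual ℂ X) (StrongDual ℂ A)).flip d).comp (orbitDual M))
  convert D.predual.add_mem (hdw (M.right a x)) (hM ψ x).2 using 1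
  ext b
  have h1 : orbit ((orbitDual M x).comp d) b =
      (translate A ℂ).flip (orbitDual M x (d b)) + (orbitDual M (M.left b x)).comp d := by
    ext b' c
    simp [hd, BanachBimodule.dualLeft, BanachBimodule.dualRight, M.right_mul, M.left_right]
  have h2 := ha (orbitDual M x (d b)) (hM (d b) x).1
  change ζ (orbit ((orbitDual M x).comp d) b) = _
  rw [h1, map_add]
  exact congrArg (· + _) h2

theorem comp_orbit_coefficient_mem_predual [FiniteDimensional ℂ K] {M : BanachBimodule A X}
    (hM : D.IsNormal M) {d : A →L[ℂ] StrongDual ℂ X}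
    (hd : ∀ a b : A, d (a * b) = M.dualLeft a (d b) + M.dualRight (d a) b)
    (hdw : D.WeakStarContinuous d) (k : K →L[ℂ] X)
    (ζ : StrongDual ℂ (A →L[ℂ] K →L[ℂ] StrongDual ℂ A)) :
    ζ.comp (orbit ((coefficient M k).comp d)) ∈ D.predual := by
  let e := Module.finBasis ℂ K
  let ι : ∀ i, (A →L[ℂ] StrongDual ℂ A) →L[ℂ] (A →L[ℂ] K →L[ℂ] StrongDual ℂ A) := fun i =>
    ContinuousLinearMap.compL ℂ A (StrongDual ℂ A) (K →L[ℂ] StrongDual ℂ A)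
      (ContinuousLinearMap.smulRightL ℂ K (StrongDual ℂ A) (e.coord i).toContinuousLinearMap)
  convert D.predual.sum_mem (t := Finset.univ) fun i _ =>
    comp_orbit_orbitDual_mem_predual hM hd hdw (k (e i)) (ζ.comp (ι i)) using 1
  ext b
  rw [sum_apply]
  simp only [ContinuousLinearMap.comp_apply]
  rw [← map_sum]
  congr 1
  ext1 c
  rw [sum_apply]
  exact clm_eq_sum_basis e (coefficient M k (d (c * b)))

/-- The operator whose orbit carries both a derivation and its right translate by `c`. -/
noncomputable def pairOperator (M : BanachBimodule A X) (d : A →L[ℂ] StrongDual ℂ X)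
    (k : K →L[ℂ] X) (c : A) :
    A →L[ℂ] (K →L[ℂ] StrongDual ℂ A) × (K →L[ℂ] StrongDual ℂ A) :=
  ((coefficient M k).comp d).prod
    (((coefficient M k).comp d).comp ((ContinuousLinearMap.mul ℂ A).flip c))

theorem comp_orbit_pairOperator_mem_predual [FiniteDimensional ℂ K] {M : BanachBimodule A X}
    (hM : D.IsNormal M) {d : A →L[ℂ] StrongDual ℂ X}
    (hd : ∀ a b : A, d (a * b) = M.dualLeft a (d b) + M.dualRight (d a) b)
    (hdw : D.WeakStarContinuous d) (k : K →L[ℂ] X) (c : A)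
    (ζ : StrongDual ℂ (A →L[ℂ] (K →L[ℂ] StrongDual ℂ A) × (K →L[ℂ] StrongDual ℂ A))) :
    ζ.comp (orbit (pairOperator M d k c)) ∈ D.predual := by
  let ι₁ := ContinuousLinearMap.compL ℂ A (K →L[ℂ] StrongDual ℂ A) _
    (ContinuousLinearMap.inl ℂ (K →L[ℂ] StrongDual ℂ A) (K →L[ℂ] StrongDual ℂ A))
  let ι₂ := ContinuousLinearMap.compL ℂ A (K →L[ℂ] StrongDual ℂ A) _
    (ContinuousLinearMap.inr ℂ (K →L[ℂ] StrongDual ℂ A) (K →L[ℂ] StrongDual ℂ A))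
  convert D.predual.add_mem
    (comp_orbit_coefficient_mem_predual hM hd hdw k (ζ.comp ι₁))
    (comp_mul_right_mem_predual
      (comp_orbit_coefficient_mem_predual hM hd hdw k (ζ.comp ι₂)) c) using 1
  ext b
  change ζ (orbit (pairOperator M d k c) b) =
    ζ (ι₁ (orbit ((coefficient M k).comp d) b)) +
      ζ (ι₂ (orbit ((coefficient M k).comp d) (b * c)))
  rw [← map_add]
  congr 1
  ext1 b'
  change (coefficient M k (d (b' * b)), coefficient M k (d (b' * b * c))) =
    (coefficient M k (d (b' * b)), 0) + (0, coefficient M k (d (b' * (b * c))))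
  rw [Prod.mk_add_mk, add_zero, zero_add, mul_assoc]

end Derivation

end DualBanachAlgebra

/-- The linear span of a finite set, as a normed space. -/
def FinsetSpan {X : Type u} [NormedAddCommGroup X] [NormedSpace ℂ X] (s : Finset X) : Type u :=
  Submodule.span ℂ (s : Set X)

namespace FinsetSpan

variable {X : Type u} [NormedAddCommGroup X] [NormedSpace ℂ X]

noncomputable instance (s : Finset X) : NormedAddCommGroup (FinsetSpan s) :=
  inferInstanceAs (NormedAddCommGroup (Submodule.span ℂ (s : Set X)))

noncomputable instance (s : Finset X) : NormedSpace ℂ (FinsetSpan s) :=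
  inferInstanceAs (NormedSpace ℂ (Submodule.span ℂ (s : Set X)))

instance (s : Finset X) : FiniteDimensional ℂ (FinsetSpan s) :=
  inferInstanceAs (FiniteDimensional ℂ (Submodule.span ℂ (s : Set X)))

instance (s : Finset X) : CompleteSpace (FinsetSpan s) :=
  FiniteDimensional.complete ℂ _

/-- The inclusion of the span. -/
noncomputable def incl (s : Finset X) : FinsetSpan s →L[ℂ] X :=
  LinearMap.mkContinuous
    { toFun := fun κ => κ.1, map_add' := fun _ _ => rfl, map_smul' := fun _ _ => rfl } 1
    fun κ => (one_mul ‖κ‖).ge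

theorem norm_incl_apply (s : Finset X) (κ : FinsetSpan s) : ‖incl s κ‖ = ‖κ‖ := rfl

theorem norm_incl_le (s : Finset X) : ‖incl s‖ ≤ 1 :=
  LinearMap.mkContinuous_norm_le _ zero_le_one _

theorem incl_injective (s : Finset X) : Function.Injective (incl s) := Subtype.coe_injective

theorem exists_incl_eq {s : Finset X} {x : X} (hx : x ∈ s) : ∃ κ, incl s κ = x :=
  ⟨⟨x, Submodule.subset_span hx⟩, rfl⟩

/-- An operator mapping one finite set into another restricts to the spans. -/
theorem exists_restrict {s t : Finset X} (f : X →L[ℂ] X) (h : ∀ x ∈ s, f x ∈ t) :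
    ∃ l : FinsetSpan s →L[ℂ] FinsetSpan t, ∀ κ, incl t (l κ) = f (incl s κ) := by
  have hspan : ∀ κ : FinsetSpan s, f (incl s κ) ∈ Submodule.span ℂ (t : Set X) := fun κ => by
    have h1 : Submodule.span ℂ (s : Set X) ≤
        (Submodule.span ℂ (t : Set X)).comap f.toLinearMap :=
      Submodule.span_le.2 fun x hx => Submodule.subset_span (h x hx)
    exact h1 κ.2
  refine ⟨LinearMap.mkContinuous
    { toFun := fun κ => ⟨f (incl s κ), hspan κ⟩
      map_add' := fun κ κ' => incl_injective t (map_add (f.comp (incl s)) κ κ')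
      map_smul' := fun c κ => incl_injective t (map_smul (f.comp (incl s)) c κ) } ‖f‖
    fun κ => f.le_opNorm (incl s κ), fun κ => rfl⟩

end FinsetSpan

namespace DualBanachAlgebra

variable {A P : Type u} [NormedRing A] [NormedAlgebra ℂ A]
  [NormedAddCommGroup P] [NormedSpace ℂ P] [CompleteSpace P]

open InterpolationSpace

/-! ### Operators between the reflexive models. -/

section CellMaps

variable {X K K' : Type u} [NormedAddCommGroup X] [NormedSpace ℂ X] [NormedAddCommGroup K]
  [NormedSpace ℂ K] [NormedAddCommGroup K'] [NormedSpace ℂ K']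

/-- The operator between interpolation spaces induced by a derivation. -/
theorem exists_map_derivation (M : BanachBimodule A X) (d : A →L[ℂ] StrongDual ℂ X)
    (k : K →L[ℂ] X) (c : A) :
    ∃ T : InterpolationSpace (orbit (pairOperator M d k c)) →L[ℂ]
        InterpolationSpace (coefficient M k),
      ‖T‖ ≤ max ‖d‖ ‖(1 : A)‖ ∧ ∀ s, proj _ (T s) = (proj _ s 1).1 := by
  -- Evaluating the first component at 1 sends the orbit of b to the coefficients of d(b), so the
  -- induced operator represents d. Its bound depends on neither k nor c, as the ℓ²-sum requires.
  let β : (A →L[ℂ] (K →L[ℂ] StrongDual ℂ A) × (K →L[ℂ] StrongDual ℂ A)) →L[ℂ]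
      (K →L[ℂ] StrongDual ℂ A) :=
    (ContinuousLinearMap.fst ℂ _ _).comp (ContinuousLinearMap.apply ℂ _ (1 : A))
  have hβ : ‖β‖ ≤ ‖(1 : A)‖ := by
    refine ContinuousLinearMap.opNorm_le_bound _ (norm_nonneg _) fun g => ?_
    calc ‖(g 1).1‖ ≤ ‖g 1‖ := norm_fst_le _
      _ ≤ ‖g‖ * ‖(1 : A)‖ := g.le_opNorm 1
      _ = ‖(1 : A)‖ * ‖g‖ := mul_comm _ _
  have hcomm : ∀ b, β (orbit (pairOperator M d k c) b) = coefficient M k (d b) := fun b => by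
    change coefficient M k (d (1 * b)) = _
    rw [one_mul]
  exact exists_map _ _ d β hcomm (le_max_left _ _) (hβ.trans (le_max_right _ _))

/-- Right translation by `c`. -/
theorem exists_map_snd (M : BanachBimodule A X) (d : A →L[ℂ] StrongDual ℂ X)
    (k : K →L[ℂ] X) (c : A) :
    ∃ S : InterpolationSpace (orbit (pairOperator M d k c)) →L[ℂ]
        InterpolationSpace (orbit (pairOperator M d k 0)),
      ∀ s, proj _ (S s) = ((ContinuousLinearMap.inl ℂ _ _).comp
        (ContinuousLinearMap.snd ℂ _ _)).comp (proj _ s) := by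
  -- The second component stores the coefficients of d(b'bc), so right multiplication by c becomes a
  -- coordinate projection. In the target, index 0 makes the second component vanish because d(b·0)
  -- = 0.
  let β := ContinuousLinearMap.compL ℂ A
    ((K →L[ℂ] StrongDual ℂ A) × (K →L[ℂ] StrongDual ℂ A))
    ((K →L[ℂ] StrongDual ℂ A) × (K →L[ℂ] StrongDual ℂ A))
    ((ContinuousLinearMap.inl ℂ _ _).comp (ContinuousLinearMap.snd ℂ _ _))
  have hcomm : ∀ b, β (orbit (pairOperator M d k c) b) =
      orbit (pairOperator M d k 0) ((ContinuousLinearMap.mul ℂ A).flip c b) := fun b => by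
    ext1 b'
    change (coefficient M k (d (b' * b * c)), 0) =
      (coefficient M k (d (b' * (b * c))), coefficient M k (d (b' * (b * c) * 0)))
    rw [mul_zero, map_zero, map_zero, mul_assoc]
  obtain ⟨S, -, hS⟩ := exists_map _ _ ((ContinuousLinearMap.mul ℂ A).flip c) β hcomm
    (le_max_left _ _) (le_max_right _ _)
  exact ⟨S, hS⟩

/-- The forgetful map. -/
theorem exists_map_fst (M : BanachBimodule A X) (d : A →L[ℂ] StrongDual ℂ X)
    (k : K →L[ℂ] X) (c : A) :
    ∃ S : InterpolationSpace (orbit (pairOperator M d k c)) →L[ℂ]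
        InterpolationSpace (orbit (pairOperator M d k 0)),
      ∀ s, proj _ (S s) = ((ContinuousLinearMap.inl ℂ _ _).comp
        (ContinuousLinearMap.fst ℂ _ _)).comp (proj _ s) := by
  let β := ContinuousLinearMap.compL ℂ A
    ((K →L[ℂ] StrongDual ℂ A) × (K →L[ℂ] StrongDual ℂ A))
    ((K →L[ℂ] StrongDual ℂ A) × (K →L[ℂ] StrongDual ℂ A))
    ((ContinuousLinearMap.inl ℂ _ _).comp (ContinuousLinearMap.fst ℂ _ _))
  have hcomm : ∀ b, β (orbit (pairOperator M d k c) b) =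
      orbit (pairOperator M d k 0) (ContinuousLinearMap.id ℂ A b) := fun b => by
    ext1 b'
    change (coefficient M k (d (b' * b)), 0) =
      (coefficient M k (d (b' * b)), coefficient M k (d (b' * b * 0)))
    rw [mul_zero, map_zero, map_zero]
  obtain ⟨S, -, hS⟩ := exists_map _ _ (ContinuousLinearMap.id ℂ A) β hcomm
    (le_max_left _ _) (le_max_right _ _)
  exact ⟨S, hS⟩

/-- Restriction along `l`, where `l` covers the operator `f` commuting with the right action. -/
theorem exists_map_restrict (M : BanachBimodule A X) (k : K →L[ℂ] X) (k' : K' →L[ℂ] X)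
    (f : X →L[ℂ] X) (hf : ∀ a x, f (M.right a x) = M.right a (f x)) (l : K' →L[ℂ] K)
    (hl : ∀ κ, k (l κ) = f (k' κ)) :
    ∃ R : InterpolationSpace (coefficient M k) →L[ℂ] InterpolationSpace (coefficient M k'),
      ∀ s, proj _ (R s) = (proj _ s).comp l := by
  let α := (ContinuousLinearMap.compL ℂ X X ℂ).flip f
  let β := (ContinuousLinearMap.compL ℂ K' K (StrongDual ℂ A)).flip l
  have hcomm : ∀ φ, β (coefficient M k φ) = coefficient M k' (α φ) := fun φ => by
    ext κ a
    change φ (M.right a (k (l κ))) = φ (f (M.right a (k' κ)))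
    rw [hl, hf]
  obtain ⟨R, -, hR⟩ := exists_map _ _ α β hcomm (le_max_left _ _) (le_max_right _ _)
  exact ⟨R, hR⟩

end CellMaps

/-- Block operators on `ℓ²`-sums of modules. -/
theorem NormalModule.lpSum_block {D : DualBanachAlgebra A P} {ι : Type u} [DecidableEq ι]
    {E : ι → Type u} [∀ i, NormedAddCommGroup (E i)] [∀ i, NormedSpace ℂ (E i)]
    {F : ι → Type u} [∀ i, NormedAddCommGroup (F i)] [∀ i, NormedSpace ℂ (F i)]
    (M : ∀ i, NormalModule D (E i)) {C : ℝ} (hC : 0 ≤ C) (hM : ∀ i, ‖(M i).act‖ ≤ C)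
    (N : ∀ i, NormalModule D (F i)) {C' : ℝ} (hC' : 0 ≤ C') (hN : ∀ i, ‖(N i).act‖ ≤ C')
    {i j : ι} (f : E i →L[ℂ] F j) (hf : ∀ a x, f ((M i).act a x) = (N j).act a (f x)) (a : A)
    (x : lp E 2) :
    lp.single 2 j (f ((lpSum M hC hM).act a x i)) =
      (lpSum N hC' hN).act a (lp.single 2 j (f (x i))) := by
  refine lp.ext (funext fun m => ?_)
  rw [lpSum_act, lpSum_act, hf]
  rcases eq_or_ne m j with rfl | hne
  · rw [lp.single_apply_self, lp.single_apply_self]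
  · rw [lp.single_apply_ne _ _ _ hne, lp.single_apply_ne _ _ _ hne, map_zero]

/-- Averaging a uniformly bounded family of operators between reflexive modules, compatibly with
all module maps between members of the family. -/
theorem Injective.exists_uniform_projection {D : DualBanachAlgebra A P} (hD : D.Injective)
    {ι : Type u} {E : ι → Type u} [∀ i, NormedAddCommGroup (E i)] [∀ i, NormedSpace ℂ (E i)]
    [∀ i, CompleteSpace (E i)] {F : ι → Type u} [∀ i, NormedAddCommGroup (F i)]
    [∀ i, NormedSpace ℂ (F i)] [∀ i, CompleteSpace (F i)]
    (hE : ∀ i, IsReflexiveSpace (E i)) (hF : ∀ i, IsReflexiveSpace (F i))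
    (M : ∀ i, NormalModule D (E i)) {C : ℝ} (hC : 0 ≤ C) (hM : ∀ i, ‖(M i).act‖ ≤ C)
    (N : ∀ i, NormalModule D (F i)) {C' : ℝ} (hC' : 0 ≤ C') (hN : ∀ i, ‖(N i).act‖ ≤ C')
    (T : ∀ i, E i →L[ℂ] F i) {B : ℝ} (hB : 0 ≤ B) (hT : ∀ i, ‖T i‖ ≤ B) :
    ∃ (B' : ℝ) (U : ∀ i, E i →L[ℂ] F i), 0 ≤ B' ∧ (∀ i, ‖U i‖ ≤ B') ∧
      (∀ i a x, U i ((M i).act a x) = (N i).act a (U i x)) ∧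
      ∀ (i j m : ι) (S S' : E i →L[ℂ] E j) (R R' : F j →L[ℂ] F m),
        (∀ a x, S ((M i).act a x) = (M j).act a (S x)) →
        (∀ a x, S' ((M i).act a x) = (M j).act a (S' x)) →
        (∀ a x, R ((N j).act a x) = (N m).act a (R x)) →
        (∀ a x, R' ((N j).act a x) = (N m).act a (R' x)) →
        (∀ a x, R (T j (S ((M i).act a x))) - R' (T j (S' ((M i).act a x))) =
          (N m).act a (R (T j (S x)) - R' (T j (S' x)))) →
        ∀ x, R (U j (S x)) - R' (U j (S' x)) = R (T j (S x)) - R' (T j (S' x)) := by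
  classical
  -- A single Q acts on the whole ℓ²-sum. The U i are the diagonal blocks of its value at the
  -- diagonal operator T₂, hence uniformly bounded and mutually compatible.
  obtain ⟨Q, hQ1, hQ2, hQ3⟩ := hD.exists_hom_projection (lp.isReflexiveSpace hE)
    (lp.isReflexiveSpace hF) (NormalModule.lpSum M hC hM) (NormalModule.lpSum N hC' hN)
  let T₂ : lp E 2 →L[ℂ] lp F 2 := lp.mapCLM 2 T hB hT
  have hT₂ : ∀ i x, T₂ (lp.single 2 i x) i = T i x := fun i x => by
    change T i (lp.single 2 i x i) = T i x
    rw [lp.single_apply_self]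
  let blk : ∀ {G H : ι → Type u} [∀ i, NormedAddCommGroup (G i)] [∀ i, NormedSpace ℂ (G i)]
      [∀ i, NormedAddCommGroup (H i)] [∀ i, NormedSpace ℂ (H i)] {i j : ι},
      (G i →L[ℂ] H j) → (lp G 2 →L[ℂ] lp H 2) := fun {G H} _ _ _ _ {i j} f =>
    (lp.singleContinuousLinearMap ℂ H 2 j).comp (f.comp (lp.evalCLM ℂ G 2 i))
  refine ⟨‖Q T₂‖, fun i => (lp.evalCLM ℂ F 2 i).comp
    ((Q T₂).comp (lp.singleContinuousLinearMap ℂ E 2 i)), norm_nonneg _, fun i => ?_,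
    fun i a x => ?_, fun i j m S S' R R' hS hS' hR hR' hN' x => ?_⟩
  · refine ContinuousLinearMap.opNorm_le_bound _ (norm_nonneg _) fun x => ?_
    calc ‖(Q T₂ (lp.single 2 i x)) i‖ ≤ ‖Q T₂ (lp.single 2 i x)‖ :=
          lp.norm_apply_le_norm (p := 2) two_ne_zero _ _
      _ ≤ ‖Q T₂‖ * ‖lp.single (E := E) 2 i x‖ := (Q T₂).le_opNorm _
      _ = ‖Q T₂‖ * ‖x‖ := by rw [lp.norm_single (by norm_num)]
  · have h1 := NormalModule.lpSum_block M hC hM M hC hM (ContinuousLinearMap.id ℂ (E i))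
      (fun _ _ => rfl) a (lp.single 2 i x)
    simp only [NormalModule.lpSum_act, lp.single_apply_self, ContinuousLinearMap.id_apply] at h1
    change Q T₂ (lp.single 2 i ((M i).act a x)) i = (N i).act a (Q T₂ (lp.single 2 i x) i)
    rw [h1, hQ1]
    rfl
  · have e1 := hQ3 (blk R) (blk S)
      (fun a y => NormalModule.lpSum_block N hC' hN N hC' hN R hR a y)
      (fun a y => NormalModule.lpSum_block M hC hM M hC hM S hS a y) T₂
    have e2 := hQ3 (blk R') (blk S')
      (fun a y => NormalModule.lpSum_block N hC' hN N hC' hN R' hR' a y)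
      (fun a y => NormalModule.lpSum_block M hC hM M hC hM S' hS' a y) T₂
    -- This difference is a module map, so Q fixes its block. Computing Q of the two terms by
    -- bimodularity and comparing (i, m) blocks gives the claim.
    let n : E i →L[ℂ] F m := R.comp ((T j).comp S) - R'.comp ((T j).comp S')
    have e3 : (blk R).comp (T₂.comp (blk S)) - (blk R').comp (T₂.comp (blk S')) = blk n := by
      refine ContinuousLinearMap.ext fun y => ?_
      change lp.single 2 m (R (T₂ (lp.single 2 j (S (y i))) j)) -
        lp.single 2 m (R' (T₂ (lp.single 2 j (S' (y i))) j)) =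
          lp.single 2 m (R (T j (S (y i))) - R' (T j (S' (y i))))
      rw [hT₂, hT₂, lp.single_sub]
    have e4 := hQ2 (blk n) fun a y => NormalModule.lpSum_block M hC hM N hC' hN n hN' a y
    rw [← e3, map_sub, e1, e2, e3] at e4
    have e5 := congrArg (fun L : lp E 2 →L[ℂ] lp F 2 => L (lp.single 2 i x) m) e4
    have e6 : lp.single 2 m (R (Q T₂ (lp.single 2 j (S (lp.single (E := E) 2 i x i))) j)) m -
        lp.single 2 m (R' (Q T₂ (lp.single 2 j (S' (lp.single (E := E) 2 i x i))) j)) m =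
          lp.single 2 m (R (T j (S (lp.single (E := E) 2 i x i))) -
            R' (T j (S' (lp.single (E := E) 2 i x i)))) m := e5
    simp only [lp.single_apply_self] at e6
    exact e6

end DualBanachAlgebra

namespace DualBanachAlgebra

variable {A P : Type u} [NormedRing A] [NormedAlgebra ℂ A]
  [NormedAddCommGroup P] [NormedSpace ℂ P] [CompleteSpace P]

open InterpolationSpace

theorem completeSpace_orbit [CompleteSpace A] {V : Type u} [NormedAddCommGroup V]
    [NormedSpace ℂ V] [CompleteSpace V] (h : A →L[ℂ] V) :
    CompleteSpace (InterpolationSpace (orbit h)) :=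
  inferInstance

theorem completeSpace_coefficient [CompleteSpace A] {X K : Type u} [NormedAddCommGroup X]
    [NormedSpace ℂ X] [NormedAddCommGroup K] [NormedSpace ℂ K] [CompleteSpace K]
    (M : BanachBimodule A X) (k : K →L[ℂ] X) :
    CompleteSpace (InterpolationSpace (coefficient M k)) :=
  inferInstance

/-! ### The derivation defect and its preservation under averaging. -/

section Intertwining

variable {D : DualBanachAlgebra A P} {Y Z Y' Z' : Type u} [NormedAddCommGroup Y] [NormedSpace ℂ Y]
  [NormedAddCommGroup Z] [NormedSpace ℂ Z] [NormedAddCommGroup Y'] [NormedSpace ℂ Y']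
  [NormedAddCommGroup Z'] [NormedSpace ℂ Z']

/-- `proj` is injective, so intertwining can be checked after projecting to Z and Z'. -/
theorem apply_act_eq {u : Y →L[ℂ] Z} {u' : Y' →L[ℂ] Z'}
    {E : NormalModule D (InterpolationSpace u)} {E' : NormalModule D (InterpolationSpace u')}
    {β : A → Z → Z} {β' : A → Z' → Z'} (hE : ∀ a y, proj _ (E.act a y) = β a (proj _ y))
    (hE' : ∀ a y, proj _ (E'.act a y) = β' a (proj _ y))
    {S : InterpolationSpace u → InterpolationSpace u'} {γ : Z → Z'}
    (hS : ∀ y, proj _ (S y) = γ (proj _ y))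
    (h : ∀ (a : A) (y : InterpolationSpace u), γ (β a (proj u y)) = β' a (γ (proj u y))) (a : A) (y : InterpolationSpace u) :
    S (E.act a y) = E'.act a (S y) := by
  refine proj_injective _ ?_
  rw [hS, hE, hE', hS, h]

theorem map_incl_one_eq {h h' : A →L[ℂ] Z} {E : NormalModule D (InterpolationSpace (orbit h'))}
    (hE : ∀ a y, proj _ (E.act a y) = translate A Z a (proj _ y))
    {S : InterpolationSpace (orbit h) → InterpolationSpace (orbit h')} {β : Z →L[ℂ] Z}
    (hS : ∀ y, proj _ (S y) = β.comp (proj _ y)) {c : A} (hβ : ∀ b, β (h b) = h' (b * c)) :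
    S (InterpolationSpace.incl _ 1) = E.act c (InterpolationSpace.incl _ 1) := by
  refine proj_injective _ (ContinuousLinearMap.ext fun b => ?_)
  rw [hS, hE, proj_incl, proj_incl]
  simp [hβ]

end Intertwining

section Defect

variable {X K K' : Type u} [NormedAddCommGroup X] [NormedSpace ℂ X] [NormedAddCommGroup K]
  [NormedSpace ℂ K] [NormedAddCommGroup K'] [NormedSpace ℂ K']

variable (A) in
/-- The operator `g ↦ (g 1).2 ∘ l - (g 1).1 ∘ l'`. -/
noncomputable def defect (l l' : K' →L[ℂ] K) :
    (A →L[ℂ] (K →L[ℂ] StrongDual ℂ A) × (K →L[ℂ] StrongDual ℂ A)) →L[ℂ]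
      (K' →L[ℂ] StrongDual ℂ A) :=
  (((ContinuousLinearMap.compL ℂ K' K (StrongDual ℂ A)).flip l).comp
      (ContinuousLinearMap.snd ℂ _ _) -
    ((ContinuousLinearMap.compL ℂ K' K (StrongDual ℂ A)).flip l').comp
      (ContinuousLinearMap.fst ℂ _ _)).comp (ContinuousLinearMap.apply ℂ _ (1 : A))

variable {M : BanachBimodule A X} {d : A →L[ℂ] StrongDual ℂ X} {k : K →L[ℂ] X} {k' : K' →L[ℂ] X}
  {c : A} {l l' : K' →L[ℂ] K}

/-- This is d(bc) − d(b)·c = b·d(c) read on coefficients: l is the inclusion and l' is left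
multiplication by c. -/
theorem defect_orbit (hd : ∀ a b : A, d (a * b) = M.dualLeft a (d b) + M.dualRight (d a) b)
    (hl : ∀ κ, k (l κ) = k' κ) (hl' : ∀ κ, k (l' κ) = M.left c (k' κ)) (b : A) :
    defect A l l' (orbit (pairOperator M d k c) b) = coefficient M k' (M.dualLeft b (d c)) := by
  ext κ a
  change d (1 * b * c) (M.right a (k (l κ))) - d (1 * b) (M.right a (k (l' κ))) =
    d c (M.right b (M.right a (k' κ)))
  rw [hl, hl', one_mul, hd, ← M.left_right]
  exact add_sub_cancel_right _ _

/-- The defect is b ↦ b·d(c) on orbits, visibly a module map; the identity is closed, so it extends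
to the interpolation space. -/
theorem defect_translate (hd : ∀ a b : A, d (a * b) = M.dualLeft a (d b) + M.dualRight (d a) b)
    (hl : ∀ κ, k (l κ) = k' κ) (hl' : ∀ κ, k (l' κ) = M.left c (k' κ)) (a : A)
    (y : InterpolationSpace (orbit (pairOperator M d k c))) :
    defect A l l' (translate A _ a (proj _ y)) =
      pointwiseTranslate A K' a (defect A l l' (proj _ y)) := by
  refine proj_induction _
    (q := fun g => defect A l l' (translate A _ a g) = pointwiseTranslate A K' a (defect A l l' g))
    ?_ (fun b => ?_) y
  · exact isClosed_eq ((defect A l l').comp (translate A _ a)).continuous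
      ((pointwiseTranslate A K' a).comp (defect A l l')).continuous
  · rw [translate_orbit, defect_orbit hd hl hl', defect_orbit hd hl hl',
      pointwiseTranslate_coefficient]
    congr 1
    ext x
    exact congrArg (d c) (M.right_mul a b x)

variable {D : DualBanachAlgebra A P}

set_option maxHeartbeats 4000000 in
/-- The identity satisfied by the averaged derivation `U`. -/
theorem translate_comp_sub_comp_eq
    (hd : ∀ a b : A, d (a * b) = M.dualLeft a (d b) + M.dualRight (d a) b)
    (hl : ∀ κ, k (l κ) = k' κ) (hl' : ∀ κ, k (l' κ) = M.left c (k' κ))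
    {E : NormalModule D (InterpolationSpace (orbit (pairOperator M d k c)))}
    (hE : ∀ a y, proj _ (E.act a y) = translate A _ a (proj _ y))
    {E₀ : NormalModule D (InterpolationSpace (orbit (pairOperator M d k 0)))}
    (hE₀ : ∀ a y, proj _ (E₀.act a y) = translate A _ a (proj _ y))
    {F : NormalModule D (InterpolationSpace (coefficient M k))}
    (hF : ∀ a y, proj _ (F.act a y) = pointwiseTranslate A K a (proj _ y))
    {F' : NormalModule D (InterpolationSpace (coefficient M k'))}
    (hF' : ∀ a y, proj _ (F'.act a y) = pointwiseTranslate A K' a (proj _ y))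
    {T U : InterpolationSpace (orbit (pairOperator M d k 0)) →L[ℂ]
      InterpolationSpace (coefficient M k)}
    (hT : ∀ y, proj _ (T y) = (proj _ y 1).1) (hU : ∀ a y, U (E₀.act a y) = F.act a (U y))
    (hUT : ∀ (S S' : InterpolationSpace (orbit (pairOperator M d k c)) →L[ℂ]
        InterpolationSpace (orbit (pairOperator M d k 0)))
      (R R' : InterpolationSpace (coefficient M k) →L[ℂ] InterpolationSpace (coefficient M k')),
      (∀ a x, S (E.act a x) = E₀.act a (S x)) → (∀ a x, S' (E.act a x) = E₀.act a (S' x)) →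
      (∀ a x, R (F.act a x) = F'.act a (R x)) → (∀ a x, R' (F.act a x) = F'.act a (R' x)) →
      (∀ a x, R (T (S (E.act a x))) - R' (T (S' (E.act a x))) =
        F'.act a (R (T (S x)) - R' (T (S' x)))) →
      ∀ x, R (U (S x)) - R' (U (S' x)) = R (T (S x)) - R' (T (S' x))) :
    (pointwiseTranslate A K c (proj _ (U (InterpolationSpace.incl _ 1)))).comp l -
      (proj _ (U (InterpolationSpace.incl _ 1))).comp l' =
        coefficient M k' (M.dualLeft 1 (d c)) := by
  obtain ⟨S, hS⟩ := exists_map_snd M d k c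
  obtain ⟨S', hS'⟩ := exists_map_fst M d k c
  obtain ⟨R, hR⟩ := exists_map_restrict M k k' (ContinuousLinearMap.id ℂ X) (fun _ _ => rfl) l hl
  obtain ⟨R', hR'⟩ := exists_map_restrict M k k' (M.left c) (M.left_right c) l' hl'
  have hdef : ∀ y, proj _ (R (T (S y)) - R' (T (S' y))) = defect A l l' (proj _ y) := fun y => by
    have h1 : proj _ (R (T (S y))) = (proj _ y 1).2.comp l := by rw [hR, hT, hS]; rfl
    have h2 : proj _ (R' (T (S' y))) = (proj _ y 1).1.comp l' := by rw [hR', hT, hS']; rfl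
    exact ((proj _).map_sub _ _).trans (congrArg₂ (· - ·) h1 h2)
  have hS1 := map_incl_one_eq hE₀ hS (c := c) fun b => by
    change (coefficient M k (d (b * c)), 0) =
      (coefficient M k (d (b * c)), coefficient M k (d (b * c * 0)))
    rw [mul_zero, map_zero, map_zero]
  have hS'1 := map_incl_one_eq hE₀ hS' (c := 1) fun b => by
    change (coefficient M k (d b), 0) =
      (coefficient M k (d (b * 1)), coefficient M k (d (b * 1 * 0)))
    rw [mul_zero, map_zero, map_zero, mul_one]
  rw [E₀.act_one] at hS'1
  -- Averaging preserves the defect, evaluated here at the image of 1. There S gives c times that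
  -- vector and S' gives the vector itself, so the module property of U produces c·w − w·c on one
  -- side and the defect of d on the other.
  have key := hUT S S' R R' (apply_act_eq hE hE₀ hS fun _ _ => rfl)
    (apply_act_eq hE hE₀ hS' fun _ _ => rfl)
    (apply_act_eq hF hF' (γ := fun w => w.comp l) hR fun _ _ => rfl)
    (apply_act_eq hF hF' (γ := fun w => w.comp l') hR' fun _ _ => rfl)
    (apply_act_eq hE hF' (S := fun y => R (T (S y)) - R' (T (S' y))) hdef
      (defect_translate hd hl hl')) (InterpolationSpace.incl _ 1)
  have h1 : proj _ (R (U (S (InterpolationSpace.incl _ 1)))) =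
      (pointwiseTranslate A K c (proj _ (U (InterpolationSpace.incl _ 1)))).comp l := by
    rw [hR, hS1, hU, hF]
  have h2 : proj _ (R' (U (S' (InterpolationSpace.incl _ 1)))) =
      (proj _ (U (InterpolationSpace.incl _ 1))).comp l' := by
    rw [hR', hS'1]
  rw [← h1, ← h2]
  refine ((proj (coefficient M k')).map_sub _ _).symm.trans ((congrArg (proj _) key).trans ?_)
  refine (hdef _).trans ((congrArg (defect A l l') (proj_incl _ 1)).trans ?_)
  exact defect_orbit hd hl hl' 1

end Defect

/-- The finite-dimensional pieces of an implementing functional, uniformly bounded. -/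
theorem Injective.exists_functional {D : DualBanachAlgebra A P} (hD : D.Injective) {X : Type u}
    [NormedAddCommGroup X] [NormedSpace ℂ X] [CompleteSpace X] {M : BanachBimodule A X}
    (hM : D.IsNormal M) {d : A →L[ℂ] StrongDual ℂ X}
    (hd : ∀ a b : A, d (a * b) = M.dualLeft a (d b) + M.dualRight (d a) b)
    (hdw : D.WeakStarContinuous d) :
    ∃ C : ℝ, ∀ s : Finset X, ∃ φ : StrongDual ℂ X, ‖φ‖ ≤ C ∧
      ∀ x ∈ s, ∀ c : A, M.right c x ∈ s → M.left c x ∈ s →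
        φ (M.right c x) - φ (M.left c x) = d c (M.right 1 x) := by
  classical
  have : CompleteSpace A := D.completeSpace
  let k := FinsetSpan.incl (X := X)
  have hws : ∀ i : Finset X × A, ∀ ζ,
      ContinuousLinearMap.comp ζ (orbit (pairOperator M d (k i.1) i.2)) ∈ D.predual :=
    fun i ζ => comp_orbit_pairOperator_mem_predual hM hd hdw (k i.1) i.2 ζ
  choose ME hME hMEp using fun i : Finset X × A => exists_module_orbit _ (hws i)
  choose NF hNF hNFp using fun i : Finset X × A => exists_module_coefficient hM (k i.1)
  choose T hT hTp using fun i : Finset X × A => exists_map_derivation M d (k i.1) i.2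
  have : ∀ i : Finset X × A,
      CompleteSpace (InterpolationSpace (orbit (pairOperator M d (k i.1) i.2))) :=
    fun i => completeSpace_orbit _
  have : ∀ i : Finset X × A, CompleteSpace (InterpolationSpace (coefficient M (k i.1))) :=
    fun i => completeSpace_coefficient M (k i.1)
  -- All finite sets and all c are treated in one family, so B is independent of both.
  obtain ⟨B, U, hB, hUB, hU, hUT⟩ := hD.exists_uniform_projection
    (fun i => isReflexiveSpace_orbit _ (hws i))
    (fun i => isReflexiveSpace_coefficient hM (k i.1)) ME zero_le_one hME NF
    (zero_le_one.trans (le_max_right _ _)) hNF T ((norm_nonneg _).trans (le_max_left _ _)) hT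
  let w : ∀ s : Finset X, FinsetSpan s →L[ℂ] StrongDual ℂ A := fun s =>
    proj _ (U (s, 0) (InterpolationSpace.incl _ 1))
  -- The factors bound `proj`, U, the inclusion of A (norm at most 2) applied to 1, and evaluation
  -- at 1.
  let C := (‖M.right‖ + 1) * (B * (2 * ‖(1 : A)‖)) * ‖(1 : A)‖
  have hC : 0 ≤ C := by positivity
  have hw : ∀ s κ, ‖w s κ 1‖ ≤ C * ‖k s κ‖ := fun s κ => by
    have h1 : ‖w s‖ ≤ (‖M.right‖ + 1) * (B * (2 * ‖(1 : A)‖)) := by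
      refine ContinuousLinearMap.le_of_opNorm_le_of_le _ ((norm_proj_le _).trans ?_) ?_
      · exact add_le_add_left (norm_coefficient_le M _ (FinsetSpan.norm_incl_le s)) 1
      · exact ContinuousLinearMap.le_of_opNorm_le_of_le _ (hUB _)
          ((InterpolationSpace.incl _).le_of_opNorm_le (InterpolationSpace.norm_incl_le _) _)
    calc ‖w s κ 1‖ ≤ ‖w s‖ * ‖κ‖ * ‖(1 : A)‖ := (w s).le_opNorm₂ κ 1
      _ ≤ (‖M.right‖ + 1) * (B * (2 * ‖(1 : A)‖)) * ‖κ‖ * ‖(1 : A)‖ := by gcongr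
      _ = C * ‖k s κ‖ := by
        rw [FinsetSpan.norm_incl_apply]
        simp only [C]
        ring
  refine ⟨C, fun s => ?_⟩
  obtain ⟨φ, hφ, hφw⟩ := exists_dual_comp_eq (k s).toLinearMap
    ((ContinuousLinearMap.apply ℂ ℂ (1 : A)).comp (w s)).toLinearMap hC (hw s)
  refine ⟨φ, hφ, fun x hx c hxc hcx => ?_⟩
  have hφw' : ∀ κ, φ (k s κ) = w s κ 1 := hφw
  let s₀ : Finset X := {x}
  obtain ⟨κ₀, hκ₀⟩ := FinsetSpan.exists_incl_eq (Finset.mem_singleton_self x : x ∈ s₀)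
  obtain ⟨κ₁, hκ₁⟩ := FinsetSpan.exists_incl_eq hxc
  obtain ⟨l, hl⟩ := FinsetSpan.exists_restrict (s := s₀) (t := s) (ContinuousLinearMap.id ℂ X)
    (by simpa [s₀] using hx)
  obtain ⟨l', hl'⟩ := FinsetSpan.exists_restrict (s := s₀) (t := s) (M.left c)
    (by simpa [s₀] using hcx)
  have key : (pointwiseTranslate A _ c (w s)).comp l - (w s).comp l' =
      coefficient M (k s₀) (M.dualLeft 1 (d c)) :=
    translate_comp_sub_comp_eq hd hl hl' (hMEp (s, c)) (hMEp (s, 0)) (hNFp (s, 0)) (hNFp (s₀, 0))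
      (hTp (s, 0)) (hU (s, 0)) (hUT (s, c) (s, 0) (s₀, 0))
  have key₁ : w s (l κ₀) (1 * c) - w s (l' κ₀) 1 = d c (M.right 1 (M.right 1 (k s₀ κ₀))) :=
    congrArg (fun v : FinsetSpan s₀ →L[ℂ] StrongDual ℂ A => v κ₀ 1) key
  -- For genuine coefficients both sides are ψ(x·c). The relation is closed, so it survives for w,
  -- which need not come from a functional on X.
  have hw₁ : w s (l κ₀) (1 * c) = w s κ₁ 1 := by
    refine proj_induction (coefficient M (k s)) (q := fun v => v (l κ₀) (1 * c) = v κ₁ 1) ?_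
      (fun ψ => ?_) _
    · exact isClosed_eq
        ((ContinuousLinearMap.apply ℂ ℂ (1 * c)).comp
          (ContinuousLinearMap.apply ℂ (StrongDual ℂ A) (l κ₀))).continuous
        ((ContinuousLinearMap.apply ℂ ℂ (1 : A)).comp
          (ContinuousLinearMap.apply ℂ (StrongDual ℂ A) κ₁)).continuous
    · change ψ (M.right (1 * c) (k s (l κ₀))) = ψ (M.right 1 (k s κ₁))
      rw [hl, hκ₁, ← M.right_mul, one_mul, mul_one, ContinuousLinearMap.id_apply, hκ₀]
  rw [hw₁, ← hφw', ← hφw', hl', hκ₁, hκ₀, ← M.right_mul, mul_one] at key₁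
  exact key₁

/-- An injective dual Banach algebra is Connes-amenable. -/
theorem Injective.connesAmenable {D : DualBanachAlgebra A P} (hD : D.Injective) :
    D.ConnesAmenable := by
  intro X _ _ _ M hM d hd hdw
  obtain ⟨C, hC⟩ := hD.exists_functional hM hd hdw
  let K : X × A → Set (WeakDual ℂ X) := fun p =>
    {φ | φ (M.right p.2 p.1) - φ (M.left p.2 p.1) = d p.2 (M.right 1 p.1)}
  have hK : ∀ p, IsClosed (K p) := fun p =>
    isClosed_eq ((WeakDual.eval_continuous _).sub (WeakDual.eval_continuous _)) continuous_const
  -- Each condition involves only x, x·c and c·x, so finitely many fit into one finite set; the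
  -- uniform bound C allows Banach–Alaoglu.
  obtain ⟨φ, -, hφ⟩ := (WeakDual.isCompact_closedBall (𝕜 := ℂ) (E := X) 0 C).inter_iInter_nonempty
    K hK fun t => by
      classical
      obtain ⟨φ, hφC, hφ⟩ := hC (t.biUnion fun p => {p.1, M.right p.2 p.1, M.left p.2 p.1})
      refine ⟨StrongDual.toWeakDual φ, mem_closedBall_zero_iff.2 hφC, Set.mem_iInter₂.2
        fun p hp => hφ p.1 ?_ p.2 ?_ ?_⟩ <;>
      exact Finset.mem_biUnion.2 ⟨p, hp, by simp⟩
  have hφ' : ∀ x c, φ (M.right c x) - φ (M.left c x) = d c (M.right 1 x) := fun x c =>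
    Set.mem_iInter.1 hφ (x, c)
  -- Applying d to 1·1 = 1 and multiplying by the unit on the left gives 1·d(1)·1 = 0.
  have h1 : ∀ x, d 1 (M.left 1 (M.right 1 x)) = 0 := fun x => by
    have h := congrArg (fun ψ : StrongDual ℂ X => ψ (M.right 1 x)) (hd 1 1)
    have h' : d (1 * 1) (M.right 1 x) =
      d 1 (M.right 1 (M.right 1 x)) + d 1 (M.left 1 (M.right 1 x)) := h
    rw [mul_one, ← M.right_mul, mul_one] at h'
    simpa using h'
  -- So far φ implements only 1·d(c). The remaining term d(1)·c of d(1c) is supplied by subtracting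
  -- d(1)·1, whose other contribution vanishes by `h1`.
  refine ⟨WeakDual.toStrongDual φ - M.dualRight (d 1) 1, fun c => ContinuousLinearMap.ext
    fun x => ?_⟩
  have h2 : d (1 * c) x = d c (M.right 1 x) + d 1 (M.left c x) :=
    congrArg (fun ψ : StrongDual ℂ X => ψ x) (hd 1 c)
  change d c x = (φ (M.right c x) - d 1 (M.left 1 (M.right c x))) -
    (φ (M.left c x) - d 1 (M.left 1 (M.left c x)))
  have h3 : d 1 (M.left 1 (M.right c x)) = 0 := by
    rw [← mul_one c, M.right_mul]
    exact h1 _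
  rw [h3, ← M.left_mul, one_mul]
  rw [one_mul, ← hφ'] at h2
  rw [h2]
  ring

end DualBanachAlgebra

/-- A submodule of a normed space as a normed space in its own right. -/
def SubmoduleSpace {W : Type u} [NormedAddCommGroup W] [NormedSpace ℂ W] (N : Submodule ℂ W) :
    Type u :=
  N

namespace SubmoduleSpace

variable {A W : Type u} [NormedAddCommGroup A] [NormedSpace ℂ A] [NormedAddCommGroup W]
  [NormedSpace ℂ W]

noncomputable instance (N : Submodule ℂ W) : NormedAddCommGroup (SubmoduleSpace N) :=
  inferInstanceAs (NormedAddCommGroup N)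

noncomputable instance (N : Submodule ℂ W) : NormedSpace ℂ (SubmoduleSpace N) :=
  inferInstanceAs (NormedSpace ℂ N)

theorem completeSpace [CompleteSpace W] {N : Submodule ℂ W} (hN : IsClosed (N : Set W)) :
    CompleteSpace (SubmoduleSpace N) :=
  hN.completeSpace_coe

/-- The inclusion map. -/
noncomputable def incl (N : Submodule ℂ W) : SubmoduleSpace N →L[ℂ] W :=
  LinearMap.mkContinuous
    { toFun := fun w => w.1, map_add' := fun _ _ => rfl, map_smul' := fun _ _ => rfl } 1
    fun w => (one_mul ‖w‖).ge

theorem incl_mem (N : Submodule ℂ W) (w : SubmoduleSpace N) : incl N w ∈ N := w.2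

theorem incl_injective (N : Submodule ℂ W) : Function.Injective (incl N) := Subtype.coe_injective

theorem exists_incl_eq {N : Submodule ℂ W} {w : W} (hw : w ∈ N) : ∃ v, incl N v = w :=
  ⟨⟨w, hw⟩, rfl⟩

theorem exists_codRestrict {N : Submodule ℂ W} (f : A →L[ℂ] W) (h : ∀ a, f a ∈ N) :
    ∃ g : A →L[ℂ] SubmoduleSpace N, ∀ a, incl N (g a) = f a :=
  ⟨LinearMap.mkContinuous
    { toFun := fun a => ⟨f a, h a⟩
      map_add' := fun a b => incl_injective N (map_add f a b)
      map_smul' := fun c a => incl_injective N (map_smul f c a) } ‖f‖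
    fun a => f.le_opNorm a, fun _ => rfl⟩

theorem exists_restrict {N : Submodule ℂ W} (β : A →L[ℂ] W →L[ℂ] W)
    (h : ∀ a, ∀ w ∈ N, β a w ∈ N) :
    ∃ γ : A →L[ℂ] SubmoduleSpace N →L[ℂ] SubmoduleSpace N,
      ∀ a w, incl N (γ a w) = β a (incl N w) :=
  ⟨LinearMap.mkContinuous₂
    (LinearMap.mk₂ ℂ (fun a w => (⟨β a (incl N w), h a _ w.2⟩ : SubmoduleSpace N))
      (fun a b w => incl_injective N (by
        change β (a + b) (incl N w) = β a (incl N w) + β b (incl N w)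
        rw [map_add, _root_.add_apply]))
      (fun c a w => incl_injective N (by
        change β (c • a) (incl N w) = c • β a (incl N w)
        rw [map_smul, _root_.smul_apply]))
      (fun a v w => incl_injective N (by
        change β a (incl N (v + w)) = β a (incl N v) + β a (incl N w)
        rw [map_add, map_add]))
      (fun c a w => incl_injective N (by
        change β a (incl N (c • w)) = c • β a (incl N w)
        rw [map_smul, map_smul]))) ‖β‖
    fun a w => β.le_opNorm₂ a (incl N w), fun _ _ => rfl⟩

theorem exists_extension {N : Submodule ℂ W} (Φ : StrongDual ℂ (SubmoduleSpace N)) :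
    ∃ Ψ : StrongDual ℂ W, ∀ w, Ψ (incl N w) = Φ w := by
  obtain ⟨Ψ, -, h⟩ := exists_dual_comp_eq (incl N).toLinearMap Φ.toLinearMap (norm_nonneg Φ)
    Φ.le_opNorm
  exact ⟨Ψ, h⟩

end SubmoduleSpace

/-! ### From Connes-amenability to injectivity. -/

namespace DualBanachAlgebra

variable {A P : Type u} [NormedRing A] [NormedAlgebra ℂ A]
  [NormedAddCommGroup P] [NormedSpace ℂ P] [CompleteSpace P]

open SubmoduleSpace

/-- A derivation into a bimodule `G` is inner if there is a separating set `Γ` of functionals on `G`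
whose closed span is a predual of `G` making `G` a normal dual bimodule. -/
theorem ConnesAmenable.exists_implementing {D : DualBanachAlgebra A P} (hD : D.ConnesAmenable)
    {G : Type u} [NormedAddCommGroup G] [NormedSpace ℂ G] (L R : A →L[ℂ] G →L[ℂ] G)
    (hL : ∀ a b U, L (a * b) U = L a (L b U)) (hR : ∀ a b U, R (a * b) U = R b (R a U))
    (hLR : ∀ a b U, L a (R b U) = R b (L a U)) (δ : A →L[ℂ] G)
    (hδ : ∀ a b, δ (a * b) = L a (δ b) + R b (δ a)) (Γ : Set (StrongDual ℂ G))
    (hΓL : ∀ a, ∀ ξ ∈ Γ, ξ.comp (L a) ∈ Γ) (hΓR : ∀ a, ∀ ξ ∈ Γ, ξ.comp (R a) ∈ Γ)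
    (hΓ : ∀ Φ : StrongDual ℂ (StrongDual ℂ G), ∃ U : G, ∀ ξ ∈ Γ, Φ ξ = ξ U)
    (hLw : ∀ ξ ∈ Γ, ∀ U, ContinuousLinearMap.comp ξ (L.flip U) ∈ D.predual)
    (hRw : ∀ ξ ∈ Γ, ∀ U, ContinuousLinearMap.comp ξ (R.flip U) ∈ D.predual)
    (hδw : ∀ ξ ∈ Γ, ContinuousLinearMap.comp ξ δ ∈ D.predual)
    (hsep : ∀ U : G, (∀ ξ ∈ Γ, ξ U = 0) → U = 0) :
    ∃ U : G, ∀ a, δ a = L a U - R a U := by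
  let N : Submodule ℂ (StrongDual ℂ G) := (Submodule.span ℂ Γ).topologicalClosure
  have hNc : IsClosed (N : Set (StrongDual ℂ G)) := Submodule.isClosed_topologicalClosure _
  have hΓN : Γ ⊆ N := Submodule.subset_span.trans (Submodule.le_topologicalClosure _)
  have : CompleteSpace (SubmoduleSpace N) := SubmoduleSpace.completeSpace hNc
  have hmin : ∀ {W : Submodule ℂ (StrongDual ℂ G)}, IsClosed (W : Set (StrongDual ℂ G)) →
      Γ ⊆ W → ∀ ξ ∈ N, ξ ∈ W := fun hW h =>
    Submodule.topologicalClosure_minimal _ (Submodule.span_le.2 h) hW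
  have hinv : ∀ β : StrongDual ℂ G →L[ℂ] StrongDual ℂ G, (∀ ξ ∈ Γ, β ξ ∈ Γ) →
      ∀ ξ ∈ N, β ξ ∈ N := fun β h =>
    hmin (W := N.comap β.toLinearMap) (hNc.preimage β.continuous) fun ξ hξ => hΓN (h ξ hξ)
  have hpre : ∀ β : StrongDual ℂ G →L[ℂ] StrongDual ℂ A, (∀ ξ ∈ Γ, β ξ ∈ D.predual) →
      ∀ ξ ∈ N, β ξ ∈ D.predual := fun β h =>
    hmin (W := D.predual.comap β.toLinearMap) (D.isClosed_predual.preimage β.continuous) h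
  -- Every functional on N is evaluation at a point of G. With separation this identifies G with N'
  -- as vector spaces; no isometry is needed.
  have hdual : ∀ Φ : StrongDual ℂ (SubmoduleSpace N), ∃ U : G, ∀ ξ, Φ ξ = incl N ξ U := by
    intro Φ
    obtain ⟨Ψ, hΨ⟩ := exists_extension Φ
    obtain ⟨U, hU⟩ := hΓ Ψ
    refine ⟨U, fun ξ => ?_⟩
    have h := hmin (W := LinearMap.ker
      (Ψ - NormedSpace.inclusionInDoubleDual ℂ G U).toLinearMap)
      (Ψ - NormedSpace.inclusionInDoubleDual ℂ G U).isClosed_ker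
      (fun ξ hξ => sub_eq_zero.2 (hU ξ hξ)) _ (incl_mem N ξ)
    rw [← hΨ]
    exact sub_eq_zero.1 h
  let comp : (G →L[ℂ] G) →L[ℂ] StrongDual ℂ G →L[ℂ] StrongDual ℂ G :=
    (ContinuousLinearMap.compL ℂ G G ℂ).flip
  -- Left and right change places in the predual: L induces the right action on N and R the left
  -- one.
  obtain ⟨r, hr⟩ := exists_restrict (N := N) (comp.comp L) fun a => hinv (comp (L a)) (hΓL a)
  obtain ⟨l, hl⟩ := exists_restrict (N := N) (comp.comp R) fun a => hinv (comp (R a)) (hΓR a)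
  have hr' : ∀ a ξ U, incl N (r a ξ) U = incl N ξ (L a U) := fun a ξ U => by rw [hr]; rfl
  have hl' : ∀ a ξ U, incl N (l a ξ) U = incl N ξ (R a U) := fun a ξ U => by rw [hl]; rfl
  let M : BanachBimodule A (SubmoduleSpace N) :=
    { left := l
      right := r
      left_mul := fun a b ξ => incl_injective N (ContinuousLinearMap.ext fun U => by
        rw [hl', hl', hl', hR])
      right_mul := fun a b ξ => incl_injective N (ContinuousLinearMap.ext fun U => by
        rw [hr', hr', hr', hL])
      left_right := fun a b ξ => incl_injective N (ContinuousLinearMap.ext fun U => by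
        rw [hl', hr', hr', hl', hLR]) }
  have hM : D.IsNormal M := by
    refine (isNormal_iff M).2 fun Φ ξ => ?_
    obtain ⟨U, hU⟩ := hdual Φ
    constructor
    · convert hpre ((ContinuousLinearMap.compL ℂ A G ℂ).flip (L.flip U))
        (fun ξ hξ => hLw ξ hξ U) _ (incl_mem N ξ) using 1
      ext a
      exact (hU (r a ξ)).trans (hr' a ξ U)
    · convert hpre ((ContinuousLinearMap.compL ℂ A G ℂ).flip (R.flip U))
        (fun ξ hξ => hRw ξ hξ U) _ (incl_mem N ξ) using 1
      ext a
      exact (hU (l a ξ)).trans (hl' a ξ U)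
  let d : A →L[ℂ] StrongDual ℂ (SubmoduleSpace N) := (incl N).flip.comp δ
  have hdw : D.WeakStarContinuous d := (weakStarContinuous_iff d).2 fun ξ =>
    hpre ((ContinuousLinearMap.compL ℂ A G ℂ).flip δ) hδw _ (incl_mem N ξ)
  have hd : ∀ a b, d (a * b) = M.dualLeft a (d b) + M.dualRight (d a) b := fun a b => by
    refine ContinuousLinearMap.ext fun ξ => ?_
    change incl N ξ (δ (a * b)) = incl N (r a ξ) (δ b) + incl N (l b ξ) (δ a)
    rw [hr', hl', hδ, map_add]
  obtain ⟨Φ, hΦ⟩ := hD (SubmoduleSpace N) M hM d hd hdw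
  obtain ⟨U, hU⟩ := hdual Φ
  refine ⟨U, fun a => sub_eq_zero.1 (hsep _ fun ξ hξ => ?_)⟩
  obtain ⟨ζ, rfl⟩ := exists_incl_eq (hΓN hξ)
  have h : incl N ζ (δ a) = Φ (r a ζ) - Φ (l a ζ) :=
    congrArg (fun Ψ : StrongDual ℂ (SubmoduleSpace N) => Ψ ζ) (hΦ a)
  rw [hU, hU, hr', hl'] at h
  rw [map_sub, map_sub, h, sub_self]

/-- A weak*-continuous unital representation is bounded with weak*-continuous coefficients. -/
theorem exists_normalModule {D : DualBanachAlgebra A P} {E : Type u} [NormedAddCommGroup E]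
    [NormedSpace ℂ E] [CompleteSpace E] (π : A →ₐ[ℂ] (E →L[ℂ] E))
    (hπ : Continuous[D.weakStar, operatorWeakStarTopology E] π) :
    ∃ M : NormalModule D E, ∀ a, M.act a = π a := by
  have : CompleteSpace A := D.completeSpace
  have hw : ∀ (μ : StrongDual ℂ E) (x : E),
      Continuous[D.weakStar, inferInstance] fun a => μ (π a x) := fun μ x => by
    -- An elementary tensor μ ⊗ x, placed at index 0 and padded by zeros.
    let τ : {p : (ℕ → StrongDual ℂ E) × (ℕ → E) // Summable fun n => ‖p.1 n‖ * ‖p.2 n‖} :=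
      ⟨(Pi.single 0 μ, Pi.single 0 x), summable_of_ne_finset_zero (s := {0}) fun n hn => by
        have : n ≠ 0 := by simpa using hn
        simp [this]⟩
    have h1 := @Continuous.comp _ _ _ D.weakStar (operatorWeakStarTopology E) _ _ _
      (@Continuous.comp _ _ _ (operatorWeakStarTopology E) _ _ _ _ (continuous_apply τ)
        continuous_induced_dom) hπ
    convert h1 using 1
    funext a
    refine Eq.trans ?_ (tsum_eq_single 0 fun n hn => ?_).symm
    · simp [τ]
    · simp [τ, hn]
  have hle : Continuous[inferInstance, D.weakStar] (id : A → A) := by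
    refine continuous_induced_rng.2 ?_
    exact NormedSpace.Dual.toWeakDual_continuous.comp D.toDual.continuous
  have hn : ∀ (μ : StrongDual ℂ E) (x : E), Continuous fun a => μ (π a x) := fun μ x => by
    have h := @Continuous.comp _ _ _ _ D.weakStar _ _ _ (hw μ x) hle
    exact h
  -- Boundedness comes from the closed graph theorem, since the scalar coefficients are norm
  -- continuous and separate operators.
  have hcont : Continuous π.toLinearMap := by
    refine π.toLinearMap.continuous_of_seq_closed_graph fun u a T hu hT => ?_
    refine ContinuousLinearMap.ext fun x => ?_
    refine (SeparatingDual.eq_iff_forall_dual_eq (R := ℂ)).2 fun μ => ?_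
    refine tendsto_nhds_unique ?_ (((hn μ x).tendsto a).comp hu)
    exact ((μ.continuous.comp (ContinuousLinearMap.apply ℂ E x).continuous).tendsto T).comp hT
  refine ⟨{ act := ⟨π.toLinearMap, hcont⟩
            act_one := fun x => ?_
            act_mul := fun a b x => ?_
            normal := fun μ x => continuous_weakStar_iff.1 (hw μ x) }, fun a => rfl⟩
  · change π 1 x = x
    rw [map_one]
    rfl
  · change π (a * b) x = π a (π b x)
    rw [map_mul]
    rfl

/-- For fixed g, μ ↦ Φ(μ ∘ g) lies in E'', which reflexivity turns into a point of E depending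
linearly on g. -/
theorem exists_apply_eq_bidual {E G : Type u} [NormedAddCommGroup E] [NormedSpace ℂ E]
    [NormedAddCommGroup G] [NormedSpace ℂ G] (hE : IsReflexiveSpace E)
    (Φ : StrongDual ℂ (StrongDual ℂ G)) :
    ∃ κ : (G →L[ℂ] E) →L[ℂ] E, ∀ g (μ : StrongDual ℂ E), μ (κ g) = Φ (μ.comp g) := by
  let J : E ≃ₗᵢ[ℂ] StrongDual ℂ (StrongDual ℂ E) :=
    LinearIsometryEquiv.ofSurjective (NormedSpace.inclusionInDoubleDualLi ℂ) hE
  refine ⟨(J.symm.toContinuousLinearEquiv : _ →L[ℂ] E).comp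
    ((ContinuousLinearMap.compL ℂ (StrongDual ℂ E) (StrongDual ℂ G) ℂ Φ).comp
      (ContinuousLinearMap.compL ℂ G E ℂ).flip), fun g μ => ?_⟩
  let η : StrongDual ℂ (StrongDual ℂ E) := Φ.comp ((ContinuousLinearMap.compL ℂ G E ℂ).flip g)
  change J (J.symm η) μ = η μ
  rw [J.apply_symm_apply]

theorem exists_operator_eq_bidual {E B G : Type u} [NormedAddCommGroup E] [NormedSpace ℂ E]
    [NormedAddCommGroup B] [NormedSpace ℂ B] [NormedAddCommGroup G] [NormedSpace ℂ G]
    (hE : IsReflexiveSpace E) (j : G →L[ℂ] B →L[ℂ] E →L[ℂ] E)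
    (Φ : StrongDual ℂ (StrongDual ℂ G)) :
    ∃ V : B →L[ℂ] E →L[ℂ] E, ∀ T x (μ : StrongDual ℂ E),
      μ (V T x) = Φ (μ.comp ((j.flip T).flip x)) := by
  obtain ⟨κ, hκ⟩ := exists_apply_eq_bidual hE Φ
  let F : (G →L[ℂ] E →L[ℂ] E) →L[ℂ] (E →L[ℂ] G →L[ℂ] E) :=
    (ContinuousLinearMap.flipₗᵢ ℂ G E E).toLinearIsometry.toContinuousLinearMap
  let C : (E →L[ℂ] G →L[ℂ] E) →L[ℂ] (E →L[ℂ] E) := ContinuousLinearMap.compL ℂ E (G →L[ℂ] E) E κ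
  refine ⟨C.comp (F.comp j.flip), fun T x μ => ?_⟩
  change μ (κ ((j.flip T).flip x)) = _
  exact hκ _ μ

section CommutantMaps

variable {E : Type u} [NormedAddCommGroup E] [NormedSpace ℂ E]

/-- The operators on `B(E)` which vanish on the commutant of `S` and are bimodule maps over it. -/
def commutantMaps (S : Set (E →L[ℂ] E)) : Submodule ℂ ((E →L[ℂ] E) →L[ℂ] (E →L[ℂ] E)) where
  carrier := {U | (∀ T ∈ Set.centralizer S, U T = 0) ∧
    ∀ c ∈ Set.centralizer S, ∀ d ∈ Set.centralizer S, ∀ T, U (c * T * d) = c * U T * d}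
  add_mem' {U V} hU hV := ⟨fun T hT => by rw [_root_.add_apply, hU.1 T hT, hV.1 T hT, add_zero],
    fun c hc d hd T => by
      rw [_root_.add_apply, _root_.add_apply, hU.2 c hc d hd, hV.2 c hc d hd, mul_add, add_mul]⟩
  zero_mem' := ⟨fun _ _ => rfl, fun c _ d _ T => by simp⟩
  smul_mem' z U hU := ⟨fun T hT => by rw [_root_.smul_apply, hU.1 T hT, smul_zero],
    fun c hc d hd T => by
      rw [_root_.smul_apply, _root_.smul_apply, hU.2 c hc d hd, mul_smul_comm, smul_mul_assoc]⟩

/-- The functional `U ↦ ⟨μ, U(T) x⟩`. -/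
noncomputable def matrixCoefficient (S : Set (E →L[ℂ] E)) (T : E →L[ℂ] E) (x : E)
    (μ : StrongDual ℂ E) : StrongDual ℂ (SubmoduleSpace (commutantMaps S)) :=
  μ.comp (((incl (commutantMaps S)).flip T).flip x)

theorem matrixCoefficient_apply (S : Set (E →L[ℂ] E)) (T : E →L[ℂ] E) (x : E)
    (μ : StrongDual ℂ E) (U : SubmoduleSpace (commutantMaps S)) :
    matrixCoefficient S T x μ U = μ (incl (commutantMaps S) U T x) := rfl

theorem matrixCoefficient_of_mem_centralizer {S : Set (E →L[ℂ] E)} {T : E →L[ℂ] E}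
    (hT : T ∈ Set.centralizer S) (x : E) (μ : StrongDual ℂ E) : matrixCoefficient S T x μ = 0 := by
  refine ContinuousLinearMap.ext fun U => ?_
  rw [matrixCoefficient_apply, (incl_mem (commutantMaps S) U).1 T hT]
  exact map_zero μ

theorem matrixCoefficient_mul_mul {S : Set (E →L[ℂ] E)} {c d : E →L[ℂ] E}
    (hc : c ∈ Set.centralizer S) (hd : d ∈ Set.centralizer S) (T : E →L[ℂ] E) (x : E)
    (μ : StrongDual ℂ E) :
    matrixCoefficient S (c * T * d) x μ = matrixCoefficient S T (d x) (μ.comp c) := by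
  refine ContinuousLinearMap.ext fun U => ?_
  rw [matrixCoefficient_apply, (incl_mem (commutantMaps S) U).2 c hc d hd]
  rfl

/-- Φ determines an operator V through its values on matrix coefficients. The conditions defining
`commutantMaps` are linear relations among matrix coefficients, so V inherits them. -/
theorem exists_matrixCoefficient_eq_bidual (hE : IsReflexiveSpace E) (S : Set (E →L[ℂ] E))
    (Φ : StrongDual ℂ (StrongDual ℂ (SubmoduleSpace (commutantMaps S)))) :
    ∃ U, ∀ T x μ, Φ (matrixCoefficient S T x μ) = matrixCoefficient S T x μ U := by
  obtain ⟨V, hV⟩ : ∃ V : (E →L[ℂ] E) →L[ℂ] (E →L[ℂ] E),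
      ∀ T x (μ : StrongDual ℂ E), μ (V T x) = Φ (matrixCoefficient S T x μ) :=
    exists_operator_eq_bidual hE (incl (commutantMaps S)) Φ
  have hsep : ∀ {T T' : E →L[ℂ] E}, (∀ x (μ : StrongDual ℂ E), μ (T x) = μ (T' x)) → T = T' :=
    fun h => ContinuousLinearMap.ext fun x =>
      (SeparatingDual.eq_iff_forall_dual_eq (R := ℂ)).2 (h x)
  have hmem : V ∈ commutantMaps S := by
    refine ⟨fun T hT => hsep fun x μ => ?_, fun c hc d hd T => hsep fun x μ => ?_⟩
    · refine (hV T x μ).trans ?_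
      rw [matrixCoefficient_of_mem_centralizer hT, _root_.zero_apply, map_zero, map_zero]
    · refine (hV _ x μ).trans ?_
      rw [matrixCoefficient_mul_mul hc hd]
      exact (hV T (d x) (μ.comp c)).symm
  obtain ⟨U, hU⟩ := exists_incl_eq hmem
  refine ⟨U, fun T x μ => ?_⟩
  rw [matrixCoefficient_apply, hU, hV]

end CommutantMaps

/-- A Connes-amenable dual Banach algebra is injective. -/
theorem ConnesAmenable.injective {D : DualBanachAlgebra A P} (hD : D.ConnesAmenable) :
    D.Injective := by
  intro E _ _ _ hE π hπ
  obtain ⟨M, hM⟩ := exists_normalModule π hπ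
  let S : Set (E →L[ℂ] E) := Set.range π
  let N := commutantMaps S
  have hcomm : ∀ {c : E →L[ℂ] E}, c ∈ Set.centralizer S → ∀ a, M.act a * c = c * M.act a :=
    fun hc a => hc _ ⟨a, (hM a).symm⟩
  have hmul : ∀ a b, M.act (a * b) = M.act a * M.act b := fun a b =>
    ContinuousLinearMap.ext (M.act_mul a b)
  let lm : A →L[ℂ] (E →L[ℂ] E) →L[ℂ] (E →L[ℂ] E) :=
    (ContinuousLinearMap.mul ℂ (E →L[ℂ] E)).comp M.act
  let rm : A →L[ℂ] (E →L[ℂ] E) →L[ℂ] (E →L[ℂ] E) :=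
    (ContinuousLinearMap.mul ℂ (E →L[ℂ] E)).flip.comp M.act
  let cp := ContinuousLinearMap.compL ℂ (E →L[ℂ] E) (E →L[ℂ] E) (E →L[ℂ] E)
  obtain ⟨L, hL⟩ := exists_restrict (N := N) (cp.comp lm) fun a U hU => by
    refine ⟨fun T hT => ?_, fun c hc d hd T => ?_⟩
    · change M.act a * U T = 0
      rw [hU.1 T hT, mul_zero]
    · change M.act a * U (c * T * d) = c * (M.act a * U T) * d
      rw [hU.2 c hc d hd, ← mul_assoc, ← mul_assoc, ← mul_assoc, hcomm hc]
  obtain ⟨R, hR⟩ := exists_restrict (N := N) (cp.comp rm) fun a U hU => by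
    refine ⟨fun T hT => ?_, fun c hc d hd T => ?_⟩
    · change U T * M.act a = 0
      rw [hU.1 T hT, zero_mul]
    · change U (c * T * d) * M.act a = c * (U T * M.act a) * d
      rw [hU.2 c hc d hd, mul_assoc, ← hcomm hd, mul_assoc, mul_assoc, mul_assoc]
  obtain ⟨δ, hδ⟩ := exists_codRestrict (N := N) (lm - rm) fun a => by
    refine ⟨fun T hT => ?_, fun c hc d hd T => ?_⟩
    · change M.act a * T - T * M.act a = 0
      rw [hcomm hT, sub_self]
    · change M.act a * (c * T * d) - c * T * d * M.act a = c * (M.act a * T - T * M.act a) * d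
      rw [mul_assoc (c * T), ← hcomm hd, ← mul_assoc, ← mul_assoc, hcomm hc]
      noncomm_ring
  have hL' : ∀ a U T, incl N (L a U) T = M.act a * incl N U T := fun a U T => by rw [hL]; rfl
  have hR' : ∀ a U T, incl N (R a U) T = incl N U T * M.act a := fun a U T => by rw [hR]; rfl
  have hδ' : ∀ a T, incl N (δ a) T = M.act a * T - T * M.act a := fun a T => by rw [hδ]; rfl
  have hext : ∀ {U V : SubmoduleSpace N}, (∀ T, incl N U T = incl N V T) → U = V := fun h =>
    incl_injective N (ContinuousLinearMap.ext h)
  let Γ : Set (StrongDual ℂ (SubmoduleSpace N)) :=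
    {ξ | ∃ T x μ, matrixCoefficient S T x μ = ξ}
  obtain ⟨U, hU⟩ := hD.exists_implementing L R
    (fun a b U => hext fun T => by rw [hL', hL', hL', hmul, mul_assoc])
    (fun a b U => hext fun T => by rw [hR', hR', hR', hmul, mul_assoc])
    (fun a b U => hext fun T => by rw [hL', hR', hR', hL', mul_assoc]) δ
    (fun a b => hext fun T => by
      rw [map_add, _root_.add_apply, hL', hR', hδ', hδ', hδ', hmul]
      noncomm_ring) Γ
    (by
      rintro a _ ⟨T, x, μ, rfl⟩
      refine ⟨T, x, μ.comp (M.act a), ContinuousLinearMap.ext fun U => ?_⟩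
      rw [ContinuousLinearMap.comp_apply, matrixCoefficient_apply, matrixCoefficient_apply, hL']
      rfl)
    (by
      rintro a _ ⟨T, x, μ, rfl⟩
      refine ⟨T, M.act a x, μ, ContinuousLinearMap.ext fun U => ?_⟩
      rw [ContinuousLinearMap.comp_apply, matrixCoefficient_apply, matrixCoefficient_apply, hR']
      rfl)
    (fun Φ => by
      obtain ⟨U, hU⟩ := exists_matrixCoefficient_eq_bidual hE S Φ
      refine ⟨U, ?_⟩
      rintro _ ⟨T, x, μ, rfl⟩
      exact hU T x μ)
    (by
      rintro _ ⟨T, x, μ, rfl⟩ U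
      convert M.normal μ (incl N U T x) using 1
      ext a
      change μ (incl N (L a U) T x) = _
      rw [hL']
      rfl)
    (by
      rintro _ ⟨T, x, μ, rfl⟩ U
      convert M.normal (μ.comp (incl N U T)) x using 1
      ext a
      change μ (incl N (R a U) T x) = _
      rw [hR']
      rfl)
    (by
      rintro _ ⟨T, x, μ, rfl⟩
      convert D.predual.sub_mem (M.normal μ (T x)) (M.normal (μ.comp T) x) using 1
      ext a
      change μ (incl N (δ a) T x) = _
      rw [hδ']
      exact map_sub μ _ _)
    (fun U h => hext fun T => ContinuousLinearMap.ext fun x =>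
      (SeparatingDual.eq_iff_forall_dual_eq (R := ℂ)).2 fun μ =>
        (h _ ⟨T, x, μ, rfl⟩).trans (map_zero μ).symm)
  have hUmem := incl_mem N U
  -- If U implements δ, then π(a)T − Tπ(a) = π(a)U(T) − U(T)π(a), so T − U(T) commutes with every
  -- π(a). Membership of U in N supplies the other two properties.
  refine ⟨ContinuousLinearMap.id ℂ (E →L[ℂ] E) - incl N U, ⟨?_, ?_, ?_⟩⟩
  · rintro T _ ⟨a, rfl⟩
    have h := hδ' a T
    rw [hU, map_sub, _root_.sub_apply, hL', hR'] at h
    change π a * (T - incl N U T) = (T - incl N U T) * π a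
    rw [← hM, mul_sub, sub_mul, sub_eq_sub_iff_sub_eq_sub, ← h]
  · intro T hT
    change T - incl N U T = T
    rw [hUmem.1 T hT, sub_zero]
  · intro c hc d hd T
    change c * T * d - incl N U (c * T * d) = c * (T - incl N U T) * d
    rw [hUmem.2 c hc d hd, mul_sub, sub_mul]

end DualBanachAlgebra

end

theorem mainTheorem1 {A P : Type u} [NormedRing A] [NormedAlgebra ℂ A]
    [NormedAddCommGroup P] [NormedSpace ℂ P] [CompleteSpace P]
    (D : DualBanachAlgebra A P) : D.ConnesAmenable ↔ D.Injective :=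
  ⟨fun h => h.injective, fun h => h.connesAmenable⟩
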